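/- Let $\nu>-1$ and $0<q<1$. Put $(a;q)_n=\prod_{k=0}^{n-1}(1-aq^k)$, $(a;q)_\infty=\prod_{k\ge 0}(1-aq^k)$, $\mathbb{R}_q=\{q^n : n\in\mathbb{Z}\}$, $\int_0^\infty f(t)\,d_qt=(1-q)\sum_{n\in\mathbb{Z}}q^nf(q^n)$, $$j_\nu(x;q^2)=\sum_{n\ge 0}(-1)^n\frac{q^{n(n+1)}}{(q^{2\nu+2};q^2)_n(q^2;q^2)_n}x^{2n},\qquad c_{q,\nu}=\frac{1}{1-q}\,\frac{(q^{2\nu+2};q^2)_\infty}{(q^2;q^2)_\infty},$$ $$\Delta_{q,\nu}f(x)=\frac{1}{x^2}\bigl[f(q^{-1}x)-(1+q^{2\nu})f(x)+q^{2\nu}f(qx)\bigr].$$ For $1\le p<\infty$ let $\mathcal{L}_{q,p,\nu}$ be the space of real functions $f$ on $\mathbb{R}_q$ with $\int_0^\infty|f(x)|^px^{2\nu+1}d_qx<\infty$. For $f$ in such a space put $$\mathcal{F}_{q,\nu}f(x)=c_{q,\nu}\int_0^\infty f(t)\,j_\nu(xt;q^2)\,t^{2\nu+1}d_qt,\qquad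 T^\nu_{q,x}f(y)=c_{q,\nu}\int_0^\infty \mathcal{F}_{q,\nu}f(t)\,j_\nu(yt;q^2)\,j_\nu(xt;q^2)\,t^{2\nu+1}d_qt .$$ Let $Q_\nu$ be the set of all $q\in(0,1)$ such that, for every $x\in\mathbb{R}_q$, $T^\nu_{q,x}f\ge 0$ on $\mathbb{R}_q$ whenever $f\ge 0$ on $\mathbb{R}_q$ and $f\in\mathcal{L}_{q,p,\nu}$ for some $1\le p<\infty$. Let $\nu>-1$ and $q\in Q_\nu$. For $x_0,x\in\mathbb{R}_q$ and $t\ge 0$ the integral $$P_{x_0}(x,t)=c_{q,\nu}^2\int_0^\infty e^{-ty^2}j_\nu(xy;q^2)\,j_\nu(x_0y;q^2)\,y^{2\nu+1}d_qy$$ converges absolutely, and $P_{x_0}$ satisfies the $q$-Fokker–Planck equation $\partial_tP_{x_0}(x,t)=\Delta_{q,\nu}P_{x_0}(x,t)$, where $\Delta_{q,\nu}$ acts in $x$ and the derivative at $t=0$ is the right derivative. Moreover, for $n,r\in\mathbb{Z}$ and $t\ge 0$, the numbers $$p_{nr}(t)=(1-q)\,q^{2(\nu+1)n}P_{q^r}(q^n,t)$$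 satisfy, for all $n,r\in\mathbb{Z}$ and $t,s\ge 0$: (a) $p_{nr}(t)\ge 0$; (b) $\sum_{n\in\mathbb{Z}}p_{nr}(t)=1$; (c) $p_{nr}(0)=1$ if $n=r$, and $p_{nr}(0)=0$ if $n\ne r$; (d) $p_{nr}(t+s)=\sum_{k\in\mathbb{Z}}p_{nk}(t)\,p_{kr}(s)$, the series converging absolutely. -/

import Mathlib

open Filter Topology

noncomputable section

namespace QFokkerPlanck

/-- The finite `q`-shifted factorial `(a; q)_n = ∏_{k < n} (1 - a q^k)`. -/
def qPoch (a q : ℝ) (n : ℕ) : ℝ := ∏ k ∈ Finset.range n, (1 - a * q ^ k)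

/-- The infinite `q`-shifted factorial `(a; q)_∞ = ∏_{k ≥ 0} (1 - a q^k)`. -/
def qPochInf (a q : ℝ) : ℝ := ∏' k : ℕ, (1 - a * q ^ k)

/-- The geometric grid `ℝ_q = {q^n : n ∈ ℤ}`. -/
def qGrid (q : ℝ) : Set ℝ := Set.range fun n : ℤ => q ^ n

/-- The `q`-Bessel operator
`Δ_{q,ν} f(x) = x⁻² [f(q⁻¹ x) - (1 + q^{2ν}) f(x) + q^{2ν} f(q x)]`. -/
def qBesselOp (q ν : ℝ) (f : ℝ → ℝ) (x : ℝ) : ℝ :=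
  (f (q⁻¹ * x) - (1 + q ^ (2 * ν)) * f x + q ^ (2 * ν) * f (q * x)) / x ^ 2

/-- The normalized `q`-Bessel function `j_ν(x; q²)`. -/
def qBesselJ (q ν x : ℝ) : ℝ :=
  ∑' n : ℕ, (-1) ^ n *
    (q ^ (n * (n + 1)) / (qPoch (q ^ (2 * ν + 2)) (q ^ 2) n * qPoch (q ^ 2) (q ^ 2) n)) *
    x ^ (2 * n)

/-- The constant `c_{q,ν} = (1 - q)⁻¹ (q^{2ν+2}; q²)_∞ / (q²; q²)_∞`. -/
def qBesselC (q ν : ℝ) : ℝ :=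
  1 / (1 - q) * (qPochInf (q ^ (2 * ν + 2)) (q ^ 2) / qPochInf (q ^ 2) (q ^ 2))

/-- Convergence of the Jackson integral of `f` over `(0, ∞)`. -/
def JacksonIntegrable (q : ℝ) (f : ℝ → ℝ) : Prop :=
  Summable fun n : ℤ => q ^ n * f (q ^ n)

/-- The Jackson integral `∫_0^∞ f(t) d_q t = (1 - q) ∑_{n ∈ ℤ} q^n f(q^n)`. -/
def jacksonIntegral (q : ℝ) (f : ℝ → ℝ) : ℝ :=
  (1 - q) * ∑' n : ℤ, q ^ n * f (q ^ n)

/-- `f` belongs to `𝓛_{q,p,ν}`: `∫_0^∞ |f(x)|^p x^{2ν+1} d_q x < ∞`.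
Only the values of `f` on `ℝ_q` matter. -/
def MemLq (q p ν : ℝ) (f : ℝ → ℝ) : Prop :=
  JacksonIntegrable q fun x => |f x| ^ p * x ^ (2 * ν + 1)

/-- The `q`-Bessel Fourier transform `𝓕_{q,ν} f`. -/
def qFourier (q ν : ℝ) (f : ℝ → ℝ) (x : ℝ) : ℝ :=
  qBesselC q ν * jacksonIntegral q fun t => f t * qBesselJ q ν (x * t) * t ^ (2 * ν + 1)

/-- The `q`-translation operator: `qTranslation q ν x f y` is `T^ν_{q,x} f(y)`. -/
def qTranslation (q ν x : ℝ) (f : ℝ → ℝ) (y : ℝ) : ℝ :=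
  qBesselC q ν * jacksonIntegral q fun t =>
    qFourier q ν f t * qBesselJ q ν (y * t) * qBesselJ q ν (x * t) * t ^ (2 * ν + 1)

/-- The positivity set `Q_ν`: those `q ∈ (0,1)` for which every `T^ν_{q,x}`, `x ∈ ℝ_q`, maps
nonnegative functions (in the spaces `𝓛_{q,p,ν}`, `1 ≤ p < ∞`, where the translation is defined)
to nonnegative functions on `ℝ_q`. -/
def positivitySet (ν : ℝ) : Set ℝ :=
  {q | q ∈ Set.Ioo (0 : ℝ) 1 ∧
    ∀ x ∈ qGrid q, ∀ p : ℝ, 1 ≤ p → ∀ f : ℝ → ℝ, MemLq q p ν f →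
      (∀ y ∈ qGrid q, 0 ≤ f y) → ∀ y ∈ qGrid q, 0 ≤ qTranslation q ν x f y}

/-- The integrand `e^{-t y²} j_ν(x y; q²) j_ν(x₀ y; q²) y^{2ν+1}`. -/
def fpIntegrand (q ν x₀ x t y : ℝ) : ℝ :=
  Real.exp (-t * y ^ 2) * qBesselJ q ν (x * y) * qBesselJ q ν (x₀ * y) * y ^ (2 * ν + 1)

/-- `P_{x₀}(x, t) = c_{q,ν}² ∫_0^∞ e^{-t y²} j_ν(x y; q²) j_ν(x₀ y; q²) y^{2ν+1} d_q y`. -/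
def fpSolution (q ν x₀ x t : ℝ) : ℝ :=
  qBesselC q ν ^ 2 * jacksonIntegral q (fpIntegrand q ν x₀ x t)

/-- `p_{nr}(t) = (1 - q) q^{2(ν+1)n} P_{q^r}(q^n, t)`. -/
def transProb (q ν : ℝ) (n r : ℤ) (t : ℝ) : ℝ :=
  (1 - q) * q ^ (2 * (ν + 1) * n) * fpSolution q ν (q ^ r) (q ^ n) t

end QFokkerPlanck

end

/-! Put Q = q², σ = q^(ν+1), w = σ². Up to the factor (1-q) c_{q,ν}, the values j_ν(q^n; q²) are the
Laurent coefficients ψ(n), in 0 < |z| < 1, of F(z) = (w/z; Q)_∞ / (z; Q)_∞. The identity F(z) F(w/z)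
= 1 says that the shifts of S(n) = σ^n ψ(n) are orthonormal. Since S(n+k) is symmetric in n and k,
the same identity is also their completeness. Moreover F(w) = 0, because (1; Q)_∞ = 0.

Hence the kernels K_g(n,r) = ∑_k g(k) S(n+k) S(r+k) form a functional calculus: g ↦ K_g is
multiplicative, the symbol 1 gives the identity, and Δ_{q,ν} multiplies symbols by -Q^k. Here
p_{nr}(t) = σ^(n-r) K_g(n,r) with g(k) = exp(-t Q^k), so the evolution equation, the initial
condition and Chapman–Kolmogorov are statements about symbols. Total mass one comes from F(w) = 0.

Nonnegativity is obtained from the operator itself: its resolvent, with symbol (1 + s Q^k)⁻¹, has a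
nonnegative kernel by a minimum principle on ℤ (`nonneg_of_supersolution`), and exp(-t Q^k) is the
limit of (1 + t Q^k / m)^(-m), whose kernels are products of resolvents. -/

namespace QFokkerPlanck

/-! ### Euler's expansions of (z; Q)_∞ and of its reciprocal -/

/-- Coefficients of Euler's expansion of `(z; Q)_∞`, extended by zero to `ℤ`. -/
noncomputable def eulerNum (Q : ℝ) (k : ℤ) : ℝ :=
  if 0 ≤ k then (-1) ^ k.toNat * Q ^ (k.toNat.choose 2) / qPoch Q Q k.toNat else 0

/-- Coefficients of Euler's expansion of `1 / (z; Q)_∞`, extended by zero to `ℤ`. -/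
noncomputable def eulerDen (Q : ℝ) (m : ℤ) : ℝ :=
  if 0 ≤ m then 1 / qPoch Q Q m.toNat else 0

lemma eulerNum_natCast (Q : ℝ) (k : ℕ) :
    eulerNum Q k = (-1) ^ k * Q ^ (k.choose 2) / qPoch Q Q k := by
  simp [eulerNum]

lemma eulerNum_of_neg (Q : ℝ) {k : ℤ} (hk : k < 0) : eulerNum Q k = 0 := by
  simp [eulerNum, not_le.2 hk]

lemma eulerDen_natCast (Q : ℝ) (k : ℕ) : eulerDen Q k = 1 / qPoch Q Q k := by
  simp [eulerDen]

lemma eulerDen_of_neg (Q : ℝ) {k : ℤ} (hk : k < 0) : eulerDen Q k = 0 := by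
  simp [eulerDen, not_le.2 hk]

lemma qPoch_succ (a Q : ℝ) (n : ℕ) : qPoch a Q (n + 1) = qPoch a Q n * (1 - a * Q ^ n) :=
  Finset.prod_range_succ _ _

lemma qPoch_pos {a Q : ℝ} (ha0 : 0 ≤ a) (ha1 : a < 1) (hQ0 : 0 < Q) (hQ1 : Q < 1) (n : ℕ) :
    0 < qPoch a Q n := by
  refine Finset.prod_pos fun k _ => ?_
  have : Q ^ k ≤ 1 := pow_le_one₀ hQ0.le hQ1.le
  have : a * Q ^ k ≤ a := mul_le_of_le_one_right ha0 this
  linarith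

lemma summable_mul_pow {a Q : ℝ} (hQ0 : 0 < Q) (hQ1 : Q < 1) : Summable fun k : ℕ => a * Q ^ k :=
  (summable_geometric_of_lt_one hQ0.le hQ1).mul_left a

lemma multipliable_qPochInf {a Q : ℝ} (hQ0 : 0 < Q) (hQ1 : Q < 1) :
    Multipliable fun k : ℕ => 1 - a * Q ^ k := by
  have := Real.multipliable_one_add_of_summable (summable_mul_pow (a := -a) hQ0 hQ1)
  simpa [sub_eq_add_neg] using this

lemma tendsto_qPoch {Q : ℝ} (a : ℝ) (hQ0 : 0 < Q) (hQ1 : Q < 1) :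
    Tendsto (qPoch a Q) atTop (𝓝 (qPochInf a Q)) :=
  (multipliable_qPochInf hQ0 hQ1).tendsto_prod_tprod_nat

lemma qPochInf_pos {a Q : ℝ} (ha0 : 0 ≤ a) (ha1 : a < 1) (hQ0 : 0 < Q) (hQ1 : Q < 1) :
    0 < qPochInf a Q := by
  have hne : qPochInf a Q ≠ 0 := by
    have := tprod_one_add_ne_zero_of_summable (R := ℝ) (f := fun k : ℕ => -(a * Q ^ k)) ?_ ?_
    · simpa [qPochInf, sub_eq_add_neg] using this
    · intro i
      have : Q ^ i ≤ 1 := pow_le_one₀ hQ0.le hQ1.le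
      have : a * Q ^ i ≤ a := mul_le_of_le_one_right ha0 this
      linarith
    · simpa using (summable_mul_pow (a := a) hQ0 hQ1).abs
  exact lt_of_le_of_ne (ge_of_tendsto' (tendsto_qPoch a hQ0 hQ1)
    fun n => (qPoch_pos ha0 ha1 hQ0 hQ1 n).le) hne.symm

/-- The zero extension respects the recurrence on all of ℤ: at k = 0 the factor 1 - Q^0 vanishes
together with the coefficient at -1. Series over ℤ can therefore be shifted without boundary terms.
-/
lemma eulerNum_rec {Q : ℝ} (hQ0 : 0 < Q) (hQ1 : Q < 1) (k : ℤ) :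
    (1 - Q ^ k) * eulerNum Q k = -Q ^ (k - 1) * eulerNum Q (k - 1) := by
  rcases lt_or_ge k 0 with hk | hk
  · rw [eulerNum_of_neg Q hk, eulerNum_of_neg Q (by omega)]; simp
  · obtain ⟨n, rfl⟩ := Int.eq_ofNat_of_zero_le hk
    rcases n with _ | n
    · simp [eulerNum_of_neg]
    · have e : ((n + 1 : ℕ) : ℤ) - 1 = n := by push_cast; ring
      rw [e, eulerNum_natCast, eulerNum_natCast, qPoch_succ, Nat.choose_succ_succ' n 1]
      have h1 := (qPoch_pos hQ0.le hQ1 hQ0 hQ1 n).ne'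
      have h2 := (qPoch_pos hQ0.le hQ1 hQ0 hQ1 (n + 1)).ne'
      rw [qPoch_succ] at h2
      have h3 := right_ne_zero_of_mul h2
      rw [zpow_natCast, zpow_natCast, Nat.choose_one_right, pow_add, pow_succ (-1 : ℝ), pow_succ Q]
      rw [mul_comm Q (Q ^ n)] at h3 ⊢
      field_simp
      rw [pow_add]

lemma eulerDen_rec {Q : ℝ} (hQ0 : 0 < Q) (hQ1 : Q < 1) (k : ℤ) :
    (1 - Q ^ k) * eulerDen Q k = eulerDen Q (k - 1) := by
  rcases lt_or_ge k 0 with hk | hk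
  · rw [eulerDen_of_neg Q hk, eulerDen_of_neg Q (by omega)]; simp
  · obtain ⟨n, rfl⟩ := Int.eq_ofNat_of_zero_le hk
    rcases n with _ | n
    · simp [eulerDen_of_neg]
    · have e : ((n + 1 : ℕ) : ℤ) - 1 = n := by push_cast; ring
      rw [e, eulerDen_natCast, eulerDen_natCast, qPoch_succ]
      have h1 := (qPoch_pos hQ0.le hQ1 hQ0 hQ1 n).ne'
      have h2 := (qPoch_pos hQ0.le hQ1 hQ0 hQ1 (n + 1)).ne'
      rw [qPoch_succ] at h2
      have h3 := right_ne_zero_of_mul h2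
      rw [zpow_natCast, pow_succ Q]
      rw [mul_comm Q (Q ^ n)] at h3 ⊢
      field_simp

lemma eulerDen_nonneg {Q : ℝ} (hQ0 : 0 < Q) (hQ1 : Q < 1) (k : ℤ) : 0 ≤ eulerDen Q k := by
  unfold eulerDen
  split_ifs
  · exact one_div_nonneg.2 (qPoch_pos hQ0.le hQ1 hQ0 hQ1 _).le
  · rfl

lemma eulerDen_bounded {Q : ℝ} (hQ0 : 0 < Q) (hQ1 : Q < 1) :
    ∃ C, 0 ≤ C ∧ ∀ k, |eulerDen Q k| ≤ C := by
  have hpos := qPochInf_pos hQ0.le hQ1 hQ0 hQ1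
  have h := ((tendsto_qPoch Q hQ0 hQ1).inv₀ hpos.ne').abs.bddAbove_range
  obtain ⟨C, hC⟩ := h
  have hC' : ∀ n : ℕ, |(qPoch Q Q n)⁻¹| ≤ C := fun n => hC ⟨n, rfl⟩
  have h0 : 0 ≤ C := (abs_nonneg _).trans (hC' 0)
  refine ⟨C, h0, fun k => ?_⟩
  unfold eulerDen
  split_ifs
  · simpa using hC' k.toNat
  · simpa using h0

/-- A series on `ℤ` with no negative terms is summable as soon as its restriction to `ℕ` is. -/
lemma summable_int_of_nat {f : ℤ → ℝ} (hf : ∀ k < 0, f k = 0) (h : Summable fun n : ℕ => f n) :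
    Summable f := by
  refine (Function.Injective.summable_iff (Nat.cast_injective (R := ℤ)) fun x hx => hf x ?_).1 h
  by_contra hc
  exact hx ⟨x.toNat, by simp; omega⟩

lemma tsum_int_eq_nat {f : ℤ → ℝ} (hf : ∀ k < 0, f k = 0) :
    ∑' k, f k = ∑' n : ℕ, f n := by
  refine ((Nat.cast_injective (R := ℤ)).tsum_eq fun x hx => ?_).symm
  have : 0 ≤ x := by
    by_contra hc
    exact hx (hf x (by omega))
  exact ⟨x.toNat, by simp; omega⟩

lemma summable_int_shift {f : ℤ → ℝ} (h : Summable f) (c : ℤ) : Summable fun k => f (k + c) :=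
  (Equiv.addRight c).summable_iff.2 h

lemma tsum_int_shift (f : ℤ → ℝ) (c : ℤ) : ∑' k, f (k + c) = ∑' k, f k :=
  (Equiv.addRight c).tsum_eq f

/-- The ratio of consecutive terms is of order Q^n, so the series is entire and no bound on ρ is
needed. -/
lemma summable_abs_eulerNum {Q : ℝ} (hQ0 : 0 < Q) (hQ1 : Q < 1) {ρ : ℝ} (hρ : 0 < ρ) :
    Summable fun k : ℤ => |eulerNum Q k| * ρ ^ k := by
  refine summable_int_of_nat (fun k hk => by simp [eulerNum_of_neg Q hk]) ?_
  have hne : ∀ n : ℕ, eulerNum Q n ≠ 0 := fun n => by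
    rw [eulerNum_natCast]
    exact div_ne_zero (mul_ne_zero (by simp) (by positivity)) (qPoch_pos hQ0.le hQ1 hQ0 hQ1 n).ne'
  have hratio : ∀ n : ℕ, |eulerNum Q (n + 1 : ℕ)| = Q ^ n / (1 - Q ^ (n + 1)) * |eulerNum Q n| := by
    intro n
    have h := eulerNum_rec hQ0 hQ1 ((n + 1 : ℕ) : ℤ)
    have e : ((n + 1 : ℕ) : ℤ) - 1 = n := by push_cast; ring
    have h1 : 0 < 1 - Q ^ (n + 1) := sub_pos.2 (pow_lt_one₀ hQ0.le hQ1 (by omega))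
    rw [e, zpow_natCast, zpow_natCast] at h
    have h' := congrArg abs h
    rw [abs_mul, abs_mul, abs_neg, abs_of_pos h1, abs_of_pos (pow_pos hQ0 n)] at h'
    rw [div_mul_eq_mul_div, eq_div_iff h1.ne', mul_comm, h']
  refine summable_of_ratio_test_tendsto_lt_one (l := 0) one_pos
    (Eventually.of_forall fun n => mul_ne_zero (abs_ne_zero.2 (hne n)) (by positivity)) ?_
  have hlim : Tendsto (fun n : ℕ => Q ^ n / (1 - Q ^ (n + 1)) * ρ) atTop (𝓝 0) := by
    have h1 := tendsto_pow_atTop_nhds_zero_of_lt_one hQ0.le hQ1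
    have h2 := (tendsto_add_atTop_iff_nat 1).2 h1
    have := (h1.div ((tendsto_const_nhds (x := (1 : ℝ))).sub h2) (by norm_num)).mul_const ρ
    simpa using this
  refine hlim.congr fun n => ?_
  have h1 : 0 < 1 - Q ^ (n + 1) := sub_pos.2 (pow_lt_one₀ hQ0.le hQ1 (by omega))
  simp only [Real.norm_eq_abs, abs_mul, abs_abs, abs_of_pos (zpow_pos hρ _)]
  rw [hratio, zpow_natCast, zpow_natCast, pow_succ ρ]
  have := abs_ne_zero.2 (hne n)
  have : ρ ^ n ≠ 0 := by positivity
  field_simp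

lemma summable_eulerNum {Q : ℝ} (hQ0 : 0 < Q) (hQ1 : Q < 1) {ρ : ℝ} (hρ : 0 < ρ) :
    Summable fun k : ℤ => eulerNum Q k * ρ ^ k := by
  refine (summable_abs_eulerNum hQ0 hQ1 hρ).of_norm_bounded fun k => ?_
  rw [norm_mul, Real.norm_eq_abs, Real.norm_of_nonneg (by positivity)]

lemma summable_eulerDen {Q : ℝ} (hQ0 : 0 < Q) (hQ1 : Q < 1) {ρ : ℝ} (hρ : 0 < ρ) (hρ1 : ρ < 1) :
    Summable fun k : ℤ => eulerDen Q k * ρ ^ k := by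
  obtain ⟨C, hC0, hC⟩ := eulerDen_bounded hQ0 hQ1
  refine summable_int_of_nat (fun k hk => by simp [eulerDen_of_neg Q hk]) ?_
  refine ((summable_geometric_of_lt_one hρ.le hρ1).mul_left C).of_norm_bounded fun k => ?_
  rw [zpow_natCast, norm_mul, Real.norm_eq_abs, Real.norm_of_nonneg (pow_nonneg hρ.le k)]
  exact mul_le_mul_of_nonneg_right (hC _) (by positivity)

/-- The two Euler expansions are inverse to each other. -/
lemma tsum_eulerNum_mul_eulerDen {Q : ℝ} (hQ0 : 0 < Q) (hQ1 : Q < 1) (s : ℤ) :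
    ∑' k, eulerNum Q k * eulerDen Q (s - k) = if s = 0 then 1 else 0 := by
  obtain ⟨C, hC0, hC⟩ := eulerDen_bounded hQ0 hQ1
  have hb : ∀ ρ : ℝ, 0 < ρ → ∀ s : ℤ,
      Summable fun k => eulerNum Q k * ρ ^ k * eulerDen Q (s - k) := fun ρ hρ s => by
    refine ((summable_abs_eulerNum hQ0 hQ1 hρ).mul_right C).of_norm_bounded fun k => ?_
    rw [norm_mul, norm_mul, Real.norm_eq_abs, Real.norm_of_nonneg (zpow_nonneg hρ.le k)]
    exact mul_le_mul_of_nonneg_left (hC _) (by positivity)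
  split_ifs with hs
  · subst hs
    rw [tsum_eq_single 0]
    · have h1 := eulerNum_natCast Q 0
      have h2 := eulerDen_natCast Q 0
      simp only [Nat.cast_zero] at h1 h2
      simp [h1, h2, qPoch]
    · intro k hk
      rcases lt_or_gt_of_ne hk with h | h
      · simp [eulerNum_of_neg Q h]
      · rw [eulerDen_of_neg Q (by omega), mul_zero]
  · have hne : 1 - Q ^ s ≠ 0 := by
      intro h
      have : Q ^ s = Q ^ (0 : ℤ) := by simp; linarith
      exact hs (zpow_right_injective₀ hQ0 hQ1.ne this)
    -- Split 1 - Q^s = (1 - Q^k) + Q^k (1 - Q^(s-k)). The two recurrences turn each term into the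
    -- difference of a summable sequence and its shift.
    have key : (1 - Q ^ s) * ∑' k, eulerNum Q k * eulerDen Q (s - k) = 0 := by
      have h1 := hb Q hQ0 (s - 1)
      have h1' : Summable fun k : ℤ => eulerNum Q (k - 1) * Q ^ (k - 1) *
          eulerDen Q (s - 1 - (k - 1)) := summable_int_shift h1 (-1)
      have e : ∀ k, (1 - Q ^ s) * (eulerNum Q k * eulerDen Q (s - k)) =
          eulerNum Q k * Q ^ k * eulerDen Q (s - 1 - k) -
            eulerNum Q (k - 1) * Q ^ (k - 1) * eulerDen Q (s - 1 - (k - 1)) := fun k => by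
        have r1 := eulerNum_rec hQ0 hQ1 k
        have r2 := eulerDen_rec hQ0 hQ1 (s - k)
        have r3 : Q ^ s = Q ^ k * Q ^ (s - k) := by rw [← zpow_add₀ hQ0.ne']; congr 1; ring
        rw [show s - 1 - k = s - k - 1 by ring, show s - 1 - (k - 1) = s - k by ring, ← r2, r3]
        linear_combination eulerDen Q (s - k) * r1
      rw [← tsum_mul_left, tsum_congr e, h1.tsum_sub h1', sub_eq_zero]
      exact (tsum_int_shift (fun k => eulerNum Q k * Q ^ k * eulerDen Q (s - 1 - k)) (-1)).symm
    exact (mul_eq_zero.1 key).resolve_left hne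

/-- The functional equation of `∑ a_k z^k`. -/
lemma tsum_eulerNum_rec {Q : ℝ} (hQ0 : 0 < Q) (hQ1 : Q < 1) {z : ℝ} (hz : 0 < z) :
    ∑' k, eulerNum Q k * z ^ k = (1 - z) * ∑' k, eulerNum Q k * (z * Q) ^ k := by
  have h1 := summable_eulerNum hQ0 hQ1 (mul_pos hz hQ0)
  have h1' : Summable fun k : ℤ => eulerNum Q (k - 1) * (z * Q) ^ (k - 1) :=
    summable_int_shift h1 (-1)
  have h2 : ∑' k : ℤ, eulerNum Q (k - 1) * (z * Q) ^ (k - 1) = ∑' k, eulerNum Q k * (z * Q) ^ k :=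
    tsum_int_shift (fun k => eulerNum Q k * (z * Q) ^ k) (-1)
  rw [sub_mul, one_mul]
  nth_rw 2 [← h2]
  rw [← tsum_mul_left, ← h1.tsum_sub (h1'.mul_left z)]
  refine tsum_congr fun k => ?_
  have r1 := eulerNum_rec hQ0 hQ1 k
  have r2 : z ^ k = z * z ^ (k - 1) := by
    rw [← zpow_one_add₀ hz.ne']; congr 1; ring
  rw [mul_zpow, mul_zpow, r2]
  rw [sub_mul, one_mul] at r1
  linear_combination z * z ^ (k - 1) * r1

lemma tsum_eulerNum_one {Q : ℝ} (hQ0 : 0 < Q) (hQ1 : Q < 1) : ∑' k, eulerNum Q k = 0 := by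
  simpa using tsum_eulerNum_rec hQ0 hQ1 one_pos

lemma eulerNum_zero (Q : ℝ) : eulerNum Q 0 = 1 := by
  have h1 := eulerNum_natCast Q 0
  simpa [qPoch] using h1

/-- Euler's expansion of `(z; Q)_∞`. -/
lemma tsum_eulerNum {Q : ℝ} (hQ0 : 0 < Q) (hQ1 : Q < 1) {z : ℝ} (hz : 0 < z) :
    ∑' k, eulerNum Q k * z ^ k = qPochInf z Q := by
  -- Iterating the functional equation n times extracts the finite product; the remaining series at
  -- z Q^n tends to its constant term 1.
  have hfin : ∀ n : ℕ, ∑' k, eulerNum Q k * z ^ k =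
      qPoch z Q n * ∑' k, eulerNum Q k * (z * Q ^ n) ^ k := fun n => by
    induction n with
    | zero => simp [qPoch]
    | succ n ih =>
      rw [ih, tsum_eulerNum_rec hQ0 hQ1 (by positivity : 0 < z * Q ^ n), qPoch_succ]
      rw [mul_assoc z, ← pow_succ]
      ring
  have hone : Tendsto (fun n : ℕ => ∑' k, eulerNum Q k * (z * Q ^ n) ^ k) atTop (𝓝 1) := by
    have hlim := tendsto_tsum_of_dominated_convergence (𝓕 := (atTop : Filter ℕ))
      (f := fun (n : ℕ) (k : ℤ) => eulerNum Q k * (z * Q ^ n) ^ k)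
      (g := fun k => if k = 0 then 1 else 0) (summable_abs_eulerNum hQ0 hQ1 hz) ?_ ?_
    · simpa using hlim
    · intro k
      rcases lt_trichotomy k 0 with hk | rfl | hk
      · simp [eulerNum_of_neg Q hk, hk.ne]
      · simp [eulerNum_zero]
      · obtain ⟨m, rfl⟩ := Int.eq_ofNat_of_zero_le hk.le
        have hm : m ≠ 0 := by omega
        have := ((tendsto_pow_atTop_nhds_zero_of_lt_one hQ0.le hQ1).const_mul z).pow m
        have := this.const_mul (eulerNum Q m)
        simpa [hm] using this
    · refine Eventually.of_forall fun n k => ?_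
      rw [norm_mul, Real.norm_eq_abs, Real.norm_of_nonneg (by positivity)]
      rcases lt_or_ge k 0 with hk | hk
      · simp [eulerNum_of_neg Q hk]
      · refine mul_le_mul_of_nonneg_left ?_ (abs_nonneg _)
        refine zpow_le_zpow_left₀ hk (by positivity) ?_
        exact mul_le_of_le_one_right hz.le (pow_le_one₀ hQ0.le hQ1.le)
  have h := (tendsto_qPoch z hQ0 hQ1).mul hone
  rw [mul_one] at h
  exact tendsto_nhds_unique (tendsto_const_nhds.congr hfin) h

lemma qPochInf_eq_qPoch_mul {Q : ℝ} (hQ0 : 0 < Q) (hQ1 : Q < 1) {z : ℝ} (hz : 0 < z) (n : ℕ) :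
    qPochInf z Q = qPoch z Q n * qPochInf (z * Q ^ n) Q := by
  induction n with
  | zero => simp [qPoch]
  | succ n ih =>
    have h := tsum_eulerNum_rec hQ0 hQ1 (by positivity : 0 < z * Q ^ n)
    rw [tsum_eulerNum hQ0 hQ1 (by positivity), tsum_eulerNum hQ0 hQ1 (by positivity)] at h
    rw [ih, qPoch_succ, h, pow_succ]
    ring_nf

/-- For m < 0 the product contains the factor 1 - Q^0 = 0, which matches the zero extension of
`eulerDen`. -/
lemma qPochInf_zpow {Q : ℝ} (hQ0 : 0 < Q) (hQ1 : Q < 1) (m : ℤ) :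
    qPochInf (Q ^ (m + 1)) Q = qPochInf Q Q * eulerDen Q m := by
  rcases lt_or_ge m 0 with hm | hm
  · obtain ⟨n, hn⟩ := Int.eq_ofNat_of_zero_le (show 0 ≤ -(m + 1) by omega)
    rw [eulerDen_of_neg Q hm, mul_zero,
      qPochInf_eq_qPoch_mul hQ0 hQ1 (zpow_pos hQ0 _) (n + 1), qPoch_succ,
      show m + 1 = -(n : ℤ) by omega, zpow_neg, zpow_natCast, inv_mul_cancel₀ (by positivity)]
    simp
  · obtain ⟨n, rfl⟩ := Int.eq_ofNat_of_zero_le hm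
    have h1 := (qPoch_pos hQ0.le hQ1 hQ0 hQ1 n).ne'
    rw [eulerDen_natCast, qPochInf_eq_qPoch_mul hQ0 hQ1 hQ0 n]
    rw [show Q ^ ((n : ℤ) + 1) = Q * Q ^ n by rw [zpow_add_one₀ hQ0.ne', zpow_natCast, mul_comm]]
    field_simp

/-! ### The q-Bessel sequence: difference equation, orthogonality, link with j_ν -/

/-- The rescaled values of the `q`-Bessel function on the grid `q^ℤ`, where `Q = q²` and
`w = q^{2ν+2}`. -/
noncomputable def besselSeq (Q w : ℝ) (n : ℤ) : ℝ :=
  ∑' k, eulerNum Q k * w ^ k * eulerDen Q (n + k)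

/-- The shear `(m, k) ↦ (m - k, k)` of `ℤ × ℤ`. -/
def shearEquiv : ℤ × ℤ ≃ ℤ × ℤ where
  toFun p := (p.1 - p.2, p.2)
  invFun p := (p.1 + p.2, p.2)
  left_inv p := by simp
  right_inv p := by simp

section besselSeq

variable {Q w : ℝ}

lemma exists_abs_eulerNum_mul_eulerDen_le (hQ0 : 0 < Q) (hQ1 : Q < 1) :
    ∃ C, 0 ≤ C ∧ ∀ (ρ : ℝ), 0 < ρ → ∀ m k : ℤ,
      |eulerNum Q k * ρ ^ k * eulerDen Q m| ≤ |eulerNum Q k| * ρ ^ k * C := by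
  obtain ⟨C, hC0, hC⟩ := eulerDen_bounded hQ0 hQ1
  refine ⟨C, hC0, fun ρ hρ m k => ?_⟩
  rw [abs_mul, abs_mul, abs_of_pos (zpow_pos hρ k)]
  exact mul_le_mul_of_nonneg_left (hC _) (by positivity)

lemma summable_besselSeq_term (hQ0 : 0 < Q) (hQ1 : Q < 1) (hw0 : 0 < w) (f : ℤ → ℤ) :
    Summable fun k => eulerNum Q k * w ^ k * eulerDen Q (f k) := by
  obtain ⟨C, hC0, hC⟩ := exists_abs_eulerNum_mul_eulerDen_le hQ0 hQ1
  exact ((summable_abs_eulerNum hQ0 hQ1 hw0).mul_right C).of_norm_bounded fun k => hC w hw0 _ k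

lemma exists_abs_tsum_le (hQ0 : 0 < Q) (hQ1 : Q < 1) (hw0 : 0 < w) :
    ∃ C, 0 ≤ C ∧ ∀ f : ℤ → ℤ, |∑' k, eulerNum Q k * w ^ k * eulerDen Q (f k)| ≤ C := by
  obtain ⟨C, hC0, hC⟩ := exists_abs_eulerNum_mul_eulerDen_le hQ0 hQ1
  have hs := (summable_abs_eulerNum hQ0 hQ1 hw0).mul_right C
  exact ⟨∑' k, |eulerNum Q k| * w ^ k * C, tsum_nonneg fun k => by positivity, fun f =>
    tsum_of_norm_bounded (f := fun k => eulerNum Q k * w ^ k * eulerDen Q (f k)) hs.hasSum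
      fun k => hC w hw0 _ k⟩

lemma besselSeq_bounded (hQ0 : 0 < Q) (hQ1 : Q < 1) (hw0 : 0 < w) :
    ∃ C, 0 ≤ C ∧ ∀ n, |besselSeq Q w n| ≤ C := by
  obtain ⟨C, hC0, hC⟩ := exists_abs_tsum_le hQ0 hQ1 hw0
  exact ⟨C, hC0, fun n => hC fun k => n + k⟩

lemma besselSeq_sub (hQ0 : 0 < Q) (hQ1 : Q < 1) (hw0 : 0 < w) (n : ℤ) :
    besselSeq Q w (n - 1) - besselSeq Q w n =
      -Q ^ n * ∑' k, eulerNum Q k * (w * Q) ^ k * eulerDen Q (n + k) := by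
  rw [besselSeq, besselSeq, ← (summable_besselSeq_term hQ0 hQ1 hw0 _).tsum_sub
    (summable_besselSeq_term hQ0 hQ1 hw0 _), ← tsum_mul_left]
  refine tsum_congr fun k => ?_
  rw [show n - 1 + k = n + k - 1 by ring, ← eulerDen_rec hQ0 hQ1, zpow_add₀ hQ0.ne', mul_zpow]
  ring

lemma abs_besselSeq_sub_le (hQ0 : 0 < Q) (hQ1 : Q < 1) (hw0 : 0 < w) :
    ∃ C, 0 ≤ C ∧ ∀ n, |besselSeq Q w (n - 1) - besselSeq Q w n| ≤ C * Q ^ n := by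
  obtain ⟨C, hC0, hC⟩ := exists_abs_tsum_le hQ0 hQ1 (mul_pos hw0 hQ0)
  refine ⟨C, hC0, fun n => ?_⟩
  rw [besselSeq_sub hQ0 hQ1 hw0, abs_mul, abs_neg, abs_of_pos (zpow_pos hQ0 n), mul_comm]
  exact mul_le_mul_of_nonneg_right (hC _) (zpow_pos hQ0 n).le

/-- The `q`-Bessel difference equation. -/
lemma besselSeq_rec (hQ0 : 0 < Q) (hQ1 : Q < 1) (hw0 : 0 < w) (n : ℤ) :
    besselSeq Q w (n - 1) - (1 + w / Q) * besselSeq Q w n + w / Q * besselSeq Q w (n + 1) =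
      -Q ^ n * besselSeq Q w n := by
  have h1 := besselSeq_sub hQ0 hQ1 hw0 n
  have h2 := besselSeq_sub hQ0 hQ1 hw0 (n + 1)
  rw [add_sub_cancel_right] at h2
  have hs : ∀ f : ℤ → ℤ, _ := fun f => summable_besselSeq_term hQ0 hQ1 (mul_pos hw0 hQ0) f
  -- Shifting k by one and using the recurrence of `eulerNum` replaces the series at n + 1 by the
  -- one at n; the term without Q^k is what produces ψ(n).
  have h3 : w * ∑' k, eulerNum Q k * (w * Q) ^ k * eulerDen Q (n + 1 + k) =
      (∑' k, eulerNum Q k * (w * Q) ^ k * eulerDen Q (n + k)) - besselSeq Q w n := by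
    rw [← tsum_int_shift _ (-1), ← tsum_mul_left, besselSeq, ← (hs _).tsum_sub
      (summable_besselSeq_term hQ0 hQ1 hw0 _)]
    refine tsum_congr fun k => ?_
    have r := eulerNum_rec hQ0 hQ1 k
    rw [show n + 1 + (k + -1) = n + k by ring, ← sub_eq_add_neg, mul_zpow, mul_zpow]
    have hw : w ^ k = w * w ^ (k - 1) := by
      rw [← zpow_one_add₀ hw0.ne']; congr 1; ring
    rw [hw]
    linear_combination (w * w ^ (k - 1) * eulerDen Q (n + k)) * r
  have hz : Q ^ (n + 1) = Q ^ n * Q := zpow_add_one₀ hQ0.ne' n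
  rw [hz] at h2
  have h4 : w / Q * (besselSeq Q w n - besselSeq Q w (n + 1)) =
      -Q ^ n * (w * ∑' k, eulerNum Q k * (w * Q) ^ k * eulerDen Q (n + 1 + k)) := by
    rw [h2]; field_simp
  rw [h3] at h4
  linear_combination h1 - h4

lemma summable_shear (hQ0 : 0 < Q) (hQ1 : Q < 1) (hw0 : 0 < w) {ρ : ℝ} (hρ0 : 0 < ρ)
    (hρ1 : ρ < 1) {θ : ℤ → ℝ} {C : ℝ} (hθ : ∀ n, |θ n| ≤ C) :
    Summable fun p : ℤ × ℤ => ρ ^ p.1 * (eulerNum Q p.2 * w ^ p.2 * eulerDen Q (p.1 + p.2)) *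
      θ p.1 := by
  -- After the shear the weights separate: ρ^(m-k) w^k = ρ^m (w/ρ)^k, and the double series is
  -- dominated by a product of two convergent ones.
  rw [← shearEquiv.summable_iff]
  have h1 := summable_eulerDen hQ0 hQ1 hρ0 hρ1
  have h2 := summable_abs_eulerNum hQ0 hQ1 (div_pos hw0 hρ0)
  have h := (h1.mul_of_nonneg h2
    (fun k => mul_nonneg (eulerDen_nonneg hQ0 hQ1 k) (by positivity))
    (fun k => by positivity)).mul_right C
  refine h.of_norm_bounded fun p => ?_
  have hC0 : 0 ≤ C := (abs_nonneg _).trans (hθ 0)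
  have e : ρ ^ (p.1 - p.2) * w ^ p.2 = ρ ^ p.1 * (w / ρ) ^ p.2 := by
    rw [zpow_sub₀ hρ0.ne', div_zpow]; ring
  have hd := eulerDen_nonneg hQ0 hQ1 p.1
  simp only [Function.comp, shearEquiv, Equiv.coe_fn_mk, sub_add_cancel, Real.norm_eq_abs, abs_mul,
    abs_of_pos (zpow_pos hρ0 _), abs_of_pos (zpow_pos hw0 _), abs_of_nonneg hd]
  calc _ = (ρ ^ (p.1 - p.2) * w ^ p.2) * |eulerNum Q p.2| * eulerDen Q p.1 * |θ (p.1 - p.2)| := by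
        ring
    _ ≤ (ρ ^ (p.1 - p.2) * w ^ p.2) * |eulerNum Q p.2| * eulerDen Q p.1 * C := by
        gcongr
        exact hθ _
    _ = _ := by rw [e]; ring

/-- Since ρ may be arbitrarily small, this encodes decay faster than any exponential at -∞. At +∞
the sequence is only bounded, whence ρ < 1. -/
lemma summable_besselSeq (hQ0 : 0 < Q) (hQ1 : Q < 1) (hw0 : 0 < w) {ρ : ℝ} (hρ0 : 0 < ρ)
    (hρ1 : ρ < 1) : Summable fun n => |besselSeq Q w n| * ρ ^ n := by
  have h := summable_shear hQ0 hQ1 hw0 hρ0 hρ1 (θ := fun _ => 1) (C := 1) (by simp)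
  have h' := h.norm.prod
  refine h'.of_norm_bounded fun n => ?_
  have e : ∑' k, ρ ^ n * (eulerNum Q k * w ^ k * eulerDen Q (n + k)) * 1 =
      besselSeq Q w n * ρ ^ n := by
    simp_rw [mul_one]
    rw [tsum_mul_left, mul_comm, besselSeq]
  have := norm_tsum_le_tsum_norm (h.norm.prod_factor n)
  simp only at this
  rw [e, norm_mul, Real.norm_of_nonneg (zpow_pos hρ0 n).le] at this
  rwa [norm_mul, Real.norm_of_nonneg (zpow_pos hρ0 n).le, Real.norm_eq_abs, abs_abs]

/-- Summation of a bounded sequence against `w^n ψ(n)`. -/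
lemma tsum_besselSeq_mul (hQ0 : 0 < Q) (hQ1 : Q < 1) (hw0 : 0 < w) (hw1 : w < 1)
    {θ : ℤ → ℝ} {C : ℝ} (hθ : ∀ n, |θ n| ≤ C) :
    ∑' n, w ^ n * besselSeq Q w n * θ n =
      ∑' m, w ^ m * eulerDen Q m * ∑' k, eulerNum Q k * θ (m - k) := by
  have h := summable_shear hQ0 hQ1 hw0 hw0 hw1 hθ
  have h1 := h.tsum_prod
  have h' := shearEquiv.summable_iff.2 h
  have h2 := h'.tsum_prod
  have h3 := shearEquiv.tsum_eq fun p : ℤ × ℤ =>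
    w ^ p.1 * (eulerNum Q p.2 * w ^ p.2 * eulerDen Q (p.1 + p.2)) * θ p.1
  simp only [Function.comp] at h2
  rw [h3, h1] at h2
  convert h2 using 1
  · refine tsum_congr fun n => ?_
    simp only
    rw [tsum_mul_right, tsum_mul_left, besselSeq]
  · refine tsum_congr fun m => ?_
    rw [← tsum_mul_left]
    refine tsum_congr fun k => ?_
    simp only [shearEquiv, Equiv.coe_fn_mk, sub_add_cancel, zpow_sub₀ hw0.ne']
    field_simp

/-- Coefficient form of (z; Q)_∞ F(z) = (w/z; Q)_∞: convolution with `eulerNum` cancels the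
`eulerDen` factor. -/
lemma tsum_eulerNum_mul_besselSeq (hQ0 : 0 < Q) (hQ1 : Q < 1) (hw0 : 0 < w) (n : ℤ) :
    ∑' k, eulerNum Q k * besselSeq Q w (n - k) = eulerNum Q (-n) * w ^ (-n) := by
  obtain ⟨C, hC0, hC⟩ := exists_abs_eulerNum_mul_eulerDen_le hQ0 hQ1
  have hs : Summable (Function.uncurry fun k l : ℤ =>
      eulerNum Q k * (eulerNum Q l * w ^ l * eulerDen Q (n - k + l))) := by
    have h1 := summable_abs_eulerNum hQ0 hQ1 one_pos
    simp only [one_zpow, mul_one] at h1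
    refine (h1.mul_of_nonneg ((summable_abs_eulerNum hQ0 hQ1 hw0).mul_right C)
      (fun k => abs_nonneg _) (fun k => by positivity)).of_norm_bounded fun p => ?_
    simp only [Function.uncurry]
    rw [norm_mul]
    exact mul_le_mul_of_nonneg_left (hC w hw0 _ _) (norm_nonneg _)
  calc ∑' k, eulerNum Q k * besselSeq Q w (n - k)
      = ∑' k, ∑' l, eulerNum Q k * (eulerNum Q l * w ^ l * eulerDen Q (n - k + l)) :=
        tsum_congr fun k => by rw [besselSeq, tsum_mul_left]
    _ = ∑' l, ∑' k, eulerNum Q k * (eulerNum Q l * w ^ l * eulerDen Q (n - k + l)) :=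
        hs.tsum_comm.symm
    _ = ∑' l, eulerNum Q l * w ^ l * if n + l = 0 then 1 else 0 := by
        refine tsum_congr fun l => ?_
        rw [← tsum_eulerNum_mul_eulerDen hQ0 hQ1, ← tsum_mul_left]
        refine tsum_congr fun k => ?_
        rw [show n - k + l = n + l - k by ring]; ring
    _ = _ := by
        rw [tsum_eq_single (-n)]
        · simp
        · intro l hl
          rw [if_neg (by omega), mul_zero]

/-- Orthogonality of the shifts of the `q`-Bessel sequence. -/
lemma tsum_besselSeq_mul_besselSeq (hQ0 : 0 < Q) (hQ1 : Q < 1) (hw0 : 0 < w) (hw1 : w < 1)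
    (d : ℤ) : ∑' n, w ^ n * besselSeq Q w n * besselSeq Q w (n + d) = if d = 0 then 1 else 0 := by
  obtain ⟨C, hC0, hC⟩ := besselSeq_bounded hQ0 hQ1 hw0
  rw [tsum_besselSeq_mul hQ0 hQ1 hw0 hw1 (θ := fun n => besselSeq Q w (n + d)) fun n => hC _]
  -- Coefficient form of F(z) F(w/z) = 1: what remains is again the convolution of the two mutually
  -- inverse Euler series.
  have e : ∀ m, w ^ m * eulerDen Q m * ∑' k, eulerNum Q k * besselSeq Q w (m - k + d) =
      w ^ (-d) * (eulerNum Q (-d - m) * eulerDen Q (-d - (-d - m))) := fun m => by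
    have h1 := tsum_eulerNum_mul_besselSeq hQ0 hQ1 hw0 (m + d)
    simp only [show ∀ k, m - k + d = m + d - k from fun k => by ring]
    rw [h1, show -(m + d) = -d - m by ring, sub_sub_cancel, zpow_sub₀ hw0.ne']
    have := (zpow_pos hw0 m).ne'
    field_simp
  have e' : ∑' m, eulerNum Q (-d - m) * eulerDen Q (-d - (-d - m)) =
      ∑' m, eulerNum Q m * eulerDen Q (-d - m) :=
    (Equiv.subLeft (-d)).tsum_eq fun m => eulerNum Q m * eulerDen Q (-d - m)
  rw [tsum_congr e, tsum_mul_left, e', tsum_eulerNum_mul_eulerDen hQ0 hQ1]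
  by_cases hd : d = 0
  · simp [hd]
  · rw [if_neg hd, if_neg (by omega), mul_zero]

/-- This is F(w) = 0: a constant sequence leaves the factor ∑ a_k = (1; Q)_∞ = 0, with a_k =
`eulerNum Q k`. -/
lemma tsum_besselSeq_zero (hQ0 : 0 < Q) (hQ1 : Q < 1) (hw0 : 0 < w) (hw1 : w < 1) :
    ∑' n, w ^ n * besselSeq Q w n = 0 := by
  have h := tsum_besselSeq_mul hQ0 hQ1 hw0 hw1 (θ := fun _ => 1) (C := 1) (by simp)
  simpa [tsum_eulerNum_one hQ0 hQ1] using h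

/-- Write (w; Q)_∞ / (w; Q)_k = (w Q^k; Q)_∞, expand it by Euler in a second index l, and sum over k
first: this gives (Q^(n+l+1); Q)_∞, a multiple of `eulerDen Q (n + l)`. -/
lemma qBesselC_mul_qBesselJ {q ν : ℝ} (hq0 : 0 < q) (hq1 : q < 1) (hν : -1 < ν) (n : ℤ) :
    (1 - q) * qBesselC q ν * qBesselJ q ν (q ^ n) =
      besselSeq (q ^ 2) (q ^ (2 * ν + 2)) n := by
  have hQ0 : 0 < q ^ 2 := by positivity
  have hQ1 : q ^ 2 < 1 := pow_lt_one₀ hq0.le hq1 (by norm_num)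
  have hw0 : 0 < q ^ (2 * ν + 2) := Real.rpow_pos_of_pos hq0 _
  have hw1 : q ^ (2 * ν + 2) < 1 := Real.rpow_lt_one hq0.le hq1 (by linarith)
  rw [qBesselC, qBesselJ]
  set Q := q ^ 2 with hQ
  set w := q ^ (2 * ν + 2)
  have hP := (qPochInf_pos hQ0.le hQ1 hQ0 hQ1).ne'
  have hq1' : 1 - q ≠ 0 := by linarith
  have hs : Summable (Function.uncurry fun k l : ℤ =>
      eulerNum Q k * (Q ^ (n + 1)) ^ k * (eulerNum Q l * (w * Q ^ k) ^ l)) := by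
    refine ((summable_abs_eulerNum hQ0 hQ1 (zpow_pos hQ0 (n + 1))).mul_of_nonneg
      (summable_abs_eulerNum hQ0 hQ1 hw0)
      (fun k => by positivity) (fun k => by positivity)).of_norm_bounded fun p => ?_
    obtain ⟨k, l⟩ := p
    simp only [Function.uncurry]
    have hk0 : 0 < (Q ^ (n + 1)) ^ k := by positivity
    have hl0 : 0 < (w * Q ^ k) ^ l := by positivity
    simp only [Real.norm_eq_abs, abs_mul, abs_of_pos hk0, abs_of_pos hl0]
    rcases lt_or_ge k 0 with hk | hk
    · simp [eulerNum_of_neg Q hk]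
    rcases lt_or_ge l 0 with hl | hl
    · simp [eulerNum_of_neg Q hl]
    refine mul_le_mul_of_nonneg_left (mul_le_mul_of_nonneg_left ?_ (abs_nonneg _)) (by positivity)
    exact zpow_le_zpow_left₀ hl (by positivity)
      (mul_le_of_le_one_right hw0.le (zpow_le_one₀ hQ0 hQ1.le hk))
  have key : qPochInf w Q * ∑' k : ℕ, (-1) ^ k * (q ^ (k * (k + 1)) / (qPoch w Q k * qPoch Q Q k)) *
      (q ^ n) ^ (2 * k) = qPochInf Q Q * besselSeq Q w n := by
    calc _ = ∑' k : ℕ, eulerNum Q k * (Q ^ (n + 1)) ^ (k : ℤ) * qPochInf (w * Q ^ (k : ℤ)) Q := by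
          rw [← tsum_mul_left]
          refine tsum_congr fun k => ?_
          have h1 := (qPoch_pos hw0.le hw1 hQ0 hQ1 k).ne'
          have h2 := (qPoch_pos hQ0.le hQ1 hQ0 hQ1 k).ne'
          rw [qPochInf_eq_qPoch_mul hQ0 hQ1 hw0 k, eulerNum_natCast, zpow_natCast, zpow_natCast]
          have h3 : q ^ (k * (k + 1)) = Q ^ (k.choose 2) * Q ^ k := by
            rw [← pow_add, hQ, ← pow_mul]
            congr 1
            have := Nat.triangle_succ k
            have h4 : k.choose 2 + k = (k + 1) * k / 2 := by
              rw [Nat.choose_two_right, ← this, Nat.add_sub_cancel]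
            have h5 : 2 ∣ (k + 1) * k := by
              rw [mul_comm]; exact (Nat.even_mul_succ_self k).two_dvd
            rw [h4, Nat.mul_div_cancel' h5, mul_comm]
          have h6 : (Q ^ (n + 1)) ^ k = Q ^ k * (q ^ n) ^ (2 * k) := by
            rw [zpow_add_one₀ hQ0.ne', mul_pow, mul_comm]
            congr 1
            rw [pow_mul, hQ, ← zpow_natCast q 2, ← zpow_natCast (q ^ n) 2, ← zpow_mul, ← zpow_mul,
              mul_comm]
          rw [h3, h6]
          field_simp
      _ = ∑' k : ℤ, eulerNum Q k * (Q ^ (n + 1)) ^ k * qPochInf (w * Q ^ k) Q :=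
          (tsum_int_eq_nat (f := fun k : ℤ => eulerNum Q k * (Q ^ (n + 1)) ^ k *
            qPochInf (w * Q ^ k) Q) fun k hk => by simp [eulerNum_of_neg Q hk]).symm
      _ = ∑' k : ℤ, ∑' l : ℤ, eulerNum Q k * (Q ^ (n + 1)) ^ k * (eulerNum Q l * (w * Q ^ k) ^ l) :=
          tsum_congr fun k => by
            rw [tsum_mul_left, tsum_eulerNum hQ0 hQ1 (by positivity)]
      _ = ∑' l : ℤ, ∑' k : ℤ, eulerNum Q k * (Q ^ (n + 1)) ^ k * (eulerNum Q l * (w * Q ^ k) ^ l) :=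
          hs.tsum_comm.symm
      _ = ∑' l : ℤ, eulerNum Q l * w ^ l * qPochInf (Q ^ (n + l + 1)) Q := by
          refine tsum_congr fun l => ?_
          rw [← tsum_eulerNum hQ0 hQ1 (zpow_pos hQ0 _), ← tsum_mul_left]
          refine tsum_congr fun k => ?_
          rw [mul_zpow, show n + l + 1 = n + 1 + l by ring, zpow_add₀ hQ0.ne' (n + 1), mul_zpow,
            ← zpow_mul Q k l, ← zpow_mul Q l k, mul_comm k l]
          ring
      _ = _ := by
          rw [besselSeq, ← tsum_mul_left]
          refine tsum_congr fun l => ?_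
          rw [qPochInf_zpow hQ0 hQ1]; ring
  have e : ∀ J : ℝ, (1 - q) * (1 / (1 - q) * (qPochInf w Q / qPochInf Q Q)) * J =
      qPochInf w Q * J / qPochInf Q Q := fun J => by field_simp
  rw [e, key, mul_div_cancel_left₀ _ hP]

end besselSeq

/-! ### Operators diagonal in a basis of shifts -/

lemma hasSum_convolution_mul {u v θ : ℤ → ℝ} {C : ℝ} (hu : Summable fun k => |u k|)
    (hv : Summable fun k => |v k|) (hθ : ∀ n, |θ n| ≤ C) :
    HasSum (fun n => (∑' k, u k * v (n + k)) * θ n) (∑' k, u k * ∑' n, v (n + k) * θ n) := by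
  have hv' : ∀ k : ℤ, Summable fun n => |v (n + k)| := fun k => summable_int_shift hv k
  have hC : 0 ≤ C := (abs_nonneg _).trans (hθ 0)
  have hs : Summable (Function.uncurry fun k n : ℤ => u k * (v (n + k) * θ n)) := by
    have e : ∀ k, ∑' n, |u k| * |v (n + k)| = |u k| * ∑' n, |v n| := fun k => by
      rw [tsum_mul_left, tsum_int_shift (fun n => |v n|) k]
    have h : Summable fun p : ℤ × ℤ => |u p.1| * |v (p.2 + p.1)| := by
      have h0 : 0 ≤ fun p : ℤ × ℤ => |u p.1| * |v (p.2 + p.1)| := fun p =>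
        mul_nonneg (abs_nonneg _) (abs_nonneg _)
      rw [summable_prod_of_nonneg h0]
      simp only [e]
      exact ⟨fun k => (hv' k).mul_left |u k|, hu.mul_right (∑' n, |v n|)⟩
    refine (h.mul_right C).of_norm_bounded fun p => ?_
    simp only [Function.uncurry, Real.norm_eq_abs, abs_mul, ← mul_assoc]
    exact mul_le_mul_of_nonneg_left (hθ p.2) (mul_nonneg (abs_nonneg _) (abs_nonneg _))
  have e1 : ∀ n, ∑' k, u k * (v (n + k) * θ n) = (∑' k, u k * v (n + k)) * θ n := fun n => by
    rw [← tsum_mul_right]; exact tsum_congr fun k => by ring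
  have e2 : ∑' k, u k * ∑' n, v (n + k) * θ n = ∑' n, (∑' k, u k * v (n + k)) * θ n := by
    simp_rw [← tsum_mul_left, ← e1]
    exact hs.tsum_comm.symm
  rw [e2]
  have h2 := hs.prod_symm.prod
  simp only [Prod.swap, Function.uncurry, e1] at h2
  exact h2.hasSum

/-- The operator with symbol `g` in the basis given by the shifts of `S`. -/
noncomputable def kernel (S g : ℤ → ℝ) (n r : ℤ) : ℝ := ∑' k, g k * (S (n + k) * S (r + k))

section kernel

variable {S g h : ℤ → ℝ} {C D : ℝ}

lemma abs_le_tsum_abs (hS : Summable fun k => |S k|) (n : ℤ) : |S n| ≤ ∑' k, |S k| :=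
  hS.le_tsum n fun _ _ => abs_nonneg _

lemma summable_mul_shift (hS : Summable fun k => |S k|) (hg : ∀ k, |g k| ≤ C) (n : ℤ) :
    Summable fun k => |g k * S (n + k)| := by
  have h1 := (summable_int_shift hS n).mul_left C
  refine h1.of_norm_bounded fun k => ?_
  rw [norm_abs_eq_norm, norm_mul, add_comm n]
  exact mul_le_mul_of_nonneg_right (hg k) (abs_nonneg _)

lemma abs_kernel_term_le (hS : Summable fun k => |S k|) (hg : ∀ k, |g k| ≤ C) (n r k : ℤ) :
    ‖g k * (S (n + k) * S (r + k))‖ ≤ C * ((∑' k, |S k|) * |S (k + r)|) := by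
  have hC : 0 ≤ C := (abs_nonneg _).trans (hg 0)
  rw [norm_mul, norm_mul, add_comm r]
  exact mul_le_mul (hg k) (mul_le_mul_of_nonneg_right (abs_le_tsum_abs hS _) (abs_nonneg _))
    (by positivity) hC

lemma summable_kernel_bound (hS : Summable fun k => |S k|) (C : ℝ) (r : ℤ) :
    Summable fun k => C * ((∑' k, |S k|) * |S (k + r)|) :=
  ((summable_int_shift hS r).mul_left _).mul_left _

lemma summable_kernel (hS : Summable fun k => |S k|) (hg : ∀ k, |g k| ≤ C) (n r : ℤ) :
    Summable fun k => g k * (S (n + k) * S (r + k)) :=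
  (summable_kernel_bound hS C r).of_norm_bounded fun k => abs_kernel_term_le hS hg n r k

lemma abs_kernel_le (hS : Summable fun k => |S k|) (hg : ∀ k, |g k| ≤ C) (r : ℤ) :
    ∃ B, ∀ n, |kernel S g n r| ≤ B :=
  ⟨∑' k, C * ((∑' k, |S k|) * |S (k + r)|), fun n => tsum_of_norm_bounded
    (f := fun k => g k * (S (n + k) * S (r + k))) (summable_kernel_bound hS C r).hasSum
    fun k => abs_kernel_term_le hS hg n r k⟩

/-- Multiplicativity of `g ↦ kernel S g` for an orthonormal system of shifts. -/
lemma hasSum_kernel_mul_kernel (hS : Summable fun k => |S k|)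
    (horth : ∀ i j, ∑' k, S (k + i) * S (k + j) = if i = j then 1 else 0)
    (hg : ∀ k, |g k| ≤ C) (hh : ∀ k, |h k| ≤ D) (n r : ℤ) :
    HasSum (fun j => kernel S g n j * kernel S h j r) (kernel S (fun k => g k * h k) n r) := by
  obtain ⟨B, hB⟩ := abs_kernel_le hS hh r
  have h1 := hasSum_convolution_mul (summable_mul_shift hS hg n) hS hB
  -- The shift of S by i is an eigenvector with eigenvalue h i: after Fubini, orthogonality keeps
  -- only k = i.
  have h2 : ∀ i, ∑' j, S (j + i) * kernel S h j r = h i * S (r + i) := fun i => by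
    have h3 := (hasSum_convolution_mul (summable_mul_shift hS hh r) hS
      (θ := fun j => S (j + i)) fun j => abs_le_tsum_abs hS _).tsum_eq
    have e : ∀ j, (∑' k, h k * S (r + k) * S (j + k)) * S (j + i) = S (j + i) * kernel S h j r :=
      fun j => by
        rw [mul_comm, kernel]
        congr 1
        exact tsum_congr fun k => by ring
    rw [tsum_congr e] at h3
    rw [h3, tsum_eq_single i]
    · rw [horth]; simp
    · intro k hk
      rw [horth, if_neg hk, mul_zero]
  have e1 : ∀ j, (∑' k, g k * S (n + k) * S (j + k)) = kernel S g n j := fun j =>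
    tsum_congr fun k => by ring
  have e2 : ∑' k, g k * S (n + k) * (h k * S (r + k)) = kernel S (fun k => g k * h k) n r :=
    tsum_congr fun k => by ring
  simp only [e1, h2, e2] at h1
  exact h1

/-- Completeness of the shifts is their orthonormality read with the roles of position and shift
exchanged. -/
lemma kernel_one (horth : ∀ i j, ∑' k, S (k + i) * S (k + j) = if i = j then 1 else 0) (n r : ℤ) :
    kernel S (fun _ => 1) n r = if n = r then 1 else 0 := by
  rw [← horth]
  exact tsum_congr fun k => by rw [one_mul, add_comm n, add_comm r]

lemma kernel_pow_nonneg (hS : Summable fun k => |S k|)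
    (horth : ∀ i j, ∑' k, S (k + i) * S (k + j) = if i = j then 1 else 0)
    (hg : ∀ k, |g k| ≤ 1) (hpos : ∀ n r, 0 ≤ kernel S g n r) (m : ℕ) (n r : ℤ) :
    0 ≤ kernel S (fun k => g k ^ m) n r := by
  induction m generalizing n r with
  | zero =>
    simp only [pow_zero, kernel_one horth]
    split_ifs <;> norm_num
  | succ m ih =>
    have hgm : ∀ k, |g k ^ m| ≤ 1 := fun k => by
      rw [abs_pow]; exact pow_le_one₀ (abs_nonneg _) (hg k)
    simp only [pow_succ]
    rw [← (hasSum_kernel_mul_kernel hS horth hgm hg n r).tsum_eq]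
    exact tsum_nonneg fun j => mul_nonneg (ih n j) (hpos j r)

lemma tendsto_kernel (hS : Summable fun k => |S k|) {G : ℕ → ℤ → ℝ} (hG : ∀ m k, |G m k| ≤ C)
    (hlim : ∀ k, Tendsto (fun m => G m k) atTop (𝓝 (g k))) (n r : ℤ) :
    Tendsto (fun m => kernel S (G m) n r) atTop (𝓝 (kernel S g n r)) :=
  tendsto_tsum_of_dominated_convergence (summable_kernel_bound hS C r)
    (fun k => (hlim k).mul_const _)
    (Eventually.of_forall fun m k => abs_kernel_term_le hS (hG m) n r k)

end kernel

/-! ### Minimum principle -/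

/-- A minimum principle on `ℤ`. -/
lemma nonneg_of_supersolution {U : ℤ → ℝ} {β : ℝ} (hβ : 0 < β) (hbot : Tendsto U atBot (𝓝 0))
    (htop : Tendsto (fun n => β ^ n * (U (n + 1) - U n)) atTop (𝓝 0))
    (h : ∀ n, U n < 0 → β * (U (n + 1) - U n) < U n - U (n - 1)) (n : ℤ) : 0 ≤ U n := by
  by_contra! hn
  -- With the weight β^n the hypothesis says that the flux D strictly decreases wherever U is
  -- negative.
  set D : ℤ → ℝ := fun n => β ^ n * (U (n + 1) - U n) with hD
  have hDlt : ∀ n, U n < 0 → D n < D (n - 1) := fun n hn => by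
    have e : β ^ n = β ^ (n - 1) * β := by rw [← zpow_add_one₀ hβ.ne']; congr 1; ring
    simp only [hD, e, sub_add_cancel, mul_assoc]
    exact mul_lt_mul_of_pos_left (h n hn) (zpow_pos hβ _)
  have hDneg : ∀ n, D n < 0 → U (n + 1) < U n := fun n hn => by
    by_contra! hc
    exact absurd hn (not_lt.2 (mul_nonneg (zpow_pos hβ _).le (sub_nonneg.2 hc)))
  have hDpos : ∀ n, 0 < D n → U n < U (n + 1) := fun n hn => by
    by_contra! hc
    exact absurd hn (not_lt.2 (mul_nonpos_of_nonneg_of_nonpos (zpow_pos hβ _).le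
      (sub_nonpos.2 hc)))
  rcases le_or_gt (D (n - 1)) 0 with h0 | h0
  -- To the right U keeps falling and stays negative, so D stays below D n < 0, against its limit 0
  -- at +∞.
  · have key : ∀ m : ℕ, U (n + m) < 0 ∧ D (n + m) ≤ D n := fun m => by
      induction m with
      | zero => simpa using hn
      | succ m ih =>
        have h1 : D (n + m) < 0 := ih.2.trans_lt ((hDlt n hn).trans_le h0)
        have h2 : U (n + (m + 1 : ℕ)) < 0 := by
          have := hDneg _ h1
          push_cast
          rw [← add_assoc]
          exact this.trans ih.1
        refine ⟨h2, ?_⟩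
        have h3 := hDlt _ h2
        rw [show n + ((m + 1 : ℕ) : ℤ) - 1 = n + m by push_cast; ring] at h3
        exact h3.le.trans ih.2
    have hle : ∀ᶠ m in atTop, D m ≤ D n := by
      filter_upwards [eventually_ge_atTop n] with m hm
      have := (key (m - n).toNat).2
      rwa [Int.toNat_of_nonneg (by omega), add_sub_cancel] at this
    have := le_of_tendsto htop hle
    linarith [hDlt n hn]
  -- To the left D stays positive, so U stays below U n < 0, against its limit 0 at -∞.
  · have key : ∀ m : ℕ, U (n - m) ≤ U n ∧ 0 < D (n - m - 1) := fun m => by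
      induction m with
      | zero => simpa using h0
      | succ m ih =>
        have h1 : U (n - m - 1) < U (n - m) := by
          have := hDpos _ ih.2
          rwa [sub_add_cancel] at this
        have h2 : U (n - m - 1) ≤ U n := h1.le.trans ih.1
        rw [show n - ((m + 1 : ℕ) : ℤ) = n - m - 1 by push_cast; ring]
        exact ⟨h2, ih.2.trans (hDlt _ (h2.trans_lt hn))⟩
    have hle : ∀ᶠ m in atBot, U m ≤ U n := by
      filter_upwards [eventually_le_atBot n] with m hm
      have := (key (n - m).toNat).1
      rwa [Int.toNat_of_nonneg (by omega), sub_sub_cancel] at this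
    have := le_of_tendsto hbot hle
    linarith

/-! ### The heat kernel: positivity, evolution equation, total mass -/

/-- The orthonormal version of `besselSeq`, with `w = σ²`. -/
noncomputable def normSeq (Q σ : ℝ) (n : ℤ) : ℝ := σ ^ n * besselSeq Q (σ ^ 2) n

section normSeq

variable {Q σ : ℝ}

lemma summable_normSeq_mul (hQ0 : 0 < Q) (hQ1 : Q < 1) (hσ0 : 0 < σ) (hσ1 : σ < 1) {ρ : ℝ}
    (hρ0 : 0 < ρ) (hρ1 : ρ ≤ 1) (r : ℤ) : Summable fun k => ρ ^ k * |normSeq Q σ (r + k)| := by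
  have h1 := summable_besselSeq hQ0 hQ1 (pow_pos hσ0 2) (mul_pos hρ0 hσ0)
    ((mul_le_of_le_one_left hσ0.le hρ1).trans_lt hσ1)
  refine ((summable_int_shift h1 r).mul_left (ρ ^ (-r))).congr fun k => ?_
  rw [normSeq, abs_mul, abs_of_pos (zpow_pos hσ0 _), mul_zpow, add_comm r, zpow_add₀ hρ0.ne',
    zpow_neg]
  have := (zpow_pos hρ0 r).ne'
  field_simp

lemma summable_abs_normSeq (hQ0 : 0 < Q) (hQ1 : Q < 1) (hσ0 : 0 < σ) (hσ1 : σ < 1) :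
    Summable fun k => |normSeq Q σ k| := by
  simpa using summable_normSeq_mul hQ0 hQ1 hσ0 hσ1 one_pos le_rfl 0

lemma tsum_normSeq_mul_normSeq (hQ0 : 0 < Q) (hQ1 : Q < 1) (hσ0 : 0 < σ) (hσ1 : σ < 1) (i j : ℤ) :
    ∑' k, normSeq Q σ (k + i) * normSeq Q σ (k + j) = if i = j then 1 else 0 := by
  have h := tsum_besselSeq_mul_besselSeq hQ0 hQ1 (pow_pos hσ0 2)
    (pow_lt_one₀ hσ0.le hσ1 two_ne_zero) (j - i)
  have e : ∀ k, normSeq Q σ (k + -i + i) * normSeq Q σ (k + -i + j) =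
      σ ^ (j - i) * ((σ ^ 2) ^ k * besselSeq Q (σ ^ 2) k * besselSeq Q (σ ^ 2) (k + (j - i))) :=
    fun k => by
      rw [neg_add_cancel_right, show k + -i + j = k + (j - i) by ring, normSeq, normSeq,
        zpow_add₀ hσ0.ne', sq σ, mul_zpow]
      ring
  rw [← tsum_int_shift _ (-i), tsum_congr e, tsum_mul_left, h]
  by_cases hij : i = j
  · simp [hij]
  · rw [if_neg (by omega), if_neg hij, mul_zero]

lemma zpow_neg_mul_normSeq (hσ0 : 0 < σ) (n k : ℤ) :
    σ ^ (-n) * normSeq Q σ (n + k) = σ ^ k * besselSeq Q (σ ^ 2) (n + k) := by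
  rw [normSeq, ← mul_assoc, ← zpow_add₀ hσ0.ne', neg_add_cancel_left]

lemma zpow_neg_mul_kernel (hσ0 : 0 < σ) (g : ℤ → ℝ) (n r : ℤ) :
    σ ^ (-n) * kernel (normSeq Q σ) g n r =
      ∑' k, g k * (σ ^ k * normSeq Q σ (r + k)) * besselSeq Q (σ ^ 2) (n + k) := by
  rw [kernel, ← tsum_mul_left]
  refine tsum_congr fun k => ?_
  have := zpow_neg_mul_normSeq (Q := Q) hσ0 n k
  linear_combination g k * normSeq Q σ (r + k) * this

lemma summable_coeff (hQ0 : 0 < Q) (hQ1 : Q < 1) (hσ0 : 0 < σ) (hσ1 : σ < 1) {g : ℤ → ℝ} {C : ℝ}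
    (hg : ∀ k, |g k| ≤ C) (r : ℤ) : Summable fun k => |g k * (σ ^ k * normSeq Q σ (r + k))| := by
  refine ((summable_normSeq_mul hQ0 hQ1 hσ0 hσ1 hσ0 hσ1.le r).mul_left C).of_norm_bounded
    fun k => ?_
  rw [norm_abs_eq_norm, norm_mul, norm_mul, Real.norm_of_nonneg (zpow_pos hσ0 k).le]
  exact mul_le_mul_of_nonneg_right (hg k) (mul_nonneg (zpow_pos hσ0 k).le (abs_nonneg _))

lemma summable_coeff_mul (hQ0 : 0 < Q) (hQ1 : Q < 1) (hσ0 : 0 < σ) (hσ1 : σ < 1) {g : ℤ → ℝ}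
    {C : ℝ} (hg : ∀ k, |g k| ≤ C) (n r : ℤ) :
    Summable fun k => g k * (σ ^ k * normSeq Q σ (r + k)) * besselSeq Q (σ ^ 2) (n + k) := by
  obtain ⟨B, hB0, hB⟩ := besselSeq_bounded hQ0 hQ1 (pow_pos hσ0 2)
  refine ((summable_coeff hQ0 hQ1 hσ0 hσ1 hg r).mul_right B).of_norm_bounded fun k => ?_
  rw [norm_mul]
  exact mul_le_mul_of_nonneg_left (hB _) (abs_nonneg _)

/-- The difference operator acts on kernels by multiplication of the symbol by `-Q^k`. -/
lemma kernel_rec (hQ0 : 0 < Q) (hQ1 : Q < 1) (hσ0 : 0 < σ) (hσ1 : σ < 1) {g : ℤ → ℝ}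
    {C : ℝ} (hg : ∀ k, |g k| ≤ C) (n r : ℤ) :
    σ ^ (-(n - 1)) * kernel (normSeq Q σ) g (n - 1) r -
      (1 + σ ^ 2 / Q) * (σ ^ (-n) * kernel (normSeq Q σ) g n r) +
      σ ^ 2 / Q * (σ ^ (-(n + 1)) * kernel (normSeq Q σ) g (n + 1) r) =
    -Q ^ n * (σ ^ (-n) * kernel (normSeq Q σ) (fun k => Q ^ k * g k) n r) := by
  have hs := fun n => summable_coeff_mul hQ0 hQ1 hσ0 hσ1 hg n r
  simp only [zpow_neg_mul_kernel hσ0]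
  rw [← tsum_mul_left, ← tsum_mul_left, ← tsum_mul_left,
    ← (hs _).tsum_sub ((hs _).mul_left _),
    ← ((hs _).sub ((hs _).mul_left _)).tsum_add ((hs _).mul_left _)]
  refine tsum_congr fun k => ?_
  have h := besselSeq_rec hQ0 hQ1 (pow_pos hσ0 2) (n + k)
  rw [zpow_add₀ hQ0.ne'] at h
  rw [show n - 1 + k = n + k - 1 by ring, show n + 1 + k = n + k + 1 by ring]
  linear_combination g k * (σ ^ k * normSeq Q σ (r + k)) * h

lemma tendsto_besselSeq_atBot (hQ0 : 0 < Q) (hQ1 : Q < 1) (hσ0 : 0 < σ) (hσ1 : σ < 1) :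
    Tendsto (besselSeq Q (σ ^ 2)) atBot (𝓝 0) := by
  have h := (summable_besselSeq hQ0 hQ1 (pow_pos hσ0 2) hσ0 hσ1).tendsto_cofinite_zero
  rw [Int.cofinite_eq] at h
  refine squeeze_zero_norm' ?_ (h.mono_left le_sup_left)
  filter_upwards [eventually_le_atBot 0] with m hm
  exact le_mul_of_one_le_right (abs_nonneg _) (one_le_zpow_of_nonpos₀ hσ0 hσ1.le hm)

lemma tendsto_kernel_atBot (hQ0 : 0 < Q) (hQ1 : Q < 1) (hσ0 : 0 < σ) (hσ1 : σ < 1) {g : ℤ → ℝ}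
    {C : ℝ} (hg : ∀ k, |g k| ≤ C) (r : ℤ) :
    Tendsto (fun n => σ ^ (-n) * kernel (normSeq Q σ) g n r) atBot (𝓝 0) := by
  obtain ⟨B, hB0, hB⟩ := besselSeq_bounded hQ0 hQ1 (pow_pos hσ0 2)
  simp only [zpow_neg_mul_kernel hσ0]
  have := tendsto_tsum_of_dominated_convergence (𝓕 := (atBot : Filter ℤ))
    (f := fun n k => g k * (σ ^ k * normSeq Q σ (r + k)) * besselSeq Q (σ ^ 2) (n + k))
    (g := fun k => 0) ((summable_coeff hQ0 hQ1 hσ0 hσ1 hg r).mul_right B) (fun k => ?_)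
    (Eventually.of_forall fun n k => ?_)
  · simpa using this
  · have h1 : Tendsto (fun n : ℤ => n + k) atBot atBot := tendsto_atBot_add_const_right _ _ tendsto_id
    simpa using ((tendsto_besselSeq_atBot hQ0 hQ1 hσ0 hσ1).comp h1).const_mul
      (g k * (σ ^ k * normSeq Q σ (r + k)))
  · rw [norm_mul]
    exact mul_le_mul_of_nonneg_left (hB _) (abs_nonneg _)

lemma tendsto_zpow_atTop_zero {x : ℝ} (hx0 : 0 < x) (hx1 : x < 1) :
    Tendsto (fun n : ℤ => x ^ n) atTop (𝓝 0) := by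
  have h := (summable_int_of_nat (f := fun n => if n < 0 then 0 else x ^ n) (fun k hk => by simp [hk])
    ((summable_geometric_of_lt_one hx0.le hx1).congr fun n => by simp)).tendsto_cofinite_zero
  rw [Int.cofinite_eq] at h
  refine (h.mono_left le_sup_right).congr' ?_
  filter_upwards [eventually_ge_atTop 0] with n hn
  rw [if_neg (not_lt.2 hn)]

/-- Differences of ψ are O(Q^n), which cancels the Q^(-n) in the weight and leaves σ^(2n). This is
the flux condition of the minimum principle. -/
lemma tendsto_kernel_sub_atTop (hQ0 : 0 < Q) (hQ1 : Q < 1) (hσ0 : 0 < σ) (hσ1 : σ < 1)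
    {g : ℤ → ℝ} {C : ℝ} (hg : ∀ k, |g k| ≤ C) (r : ℤ) :
    Tendsto (fun n => (σ ^ 2 / Q) ^ n * (σ ^ (-(n + 1)) * kernel (normSeq Q σ) g (n + 1) r -
      σ ^ (-n) * kernel (normSeq Q σ) g n r)) atTop (𝓝 0) := by
  obtain ⟨B, hB⟩ := abs_besselSeq_sub_le hQ0 hQ1 (pow_pos hσ0 2)
  have hC : 0 ≤ C := (abs_nonneg _).trans (hg 0)
  have hs := (summable_normSeq_mul hQ0 hQ1 hσ0 hσ1 (mul_pos hσ0 hQ0)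
    (mul_le_one₀ hσ1.le hQ0.le hQ1.le) r).mul_left (C * B * Q)
  set K := ∑' k, C * B * Q * ((σ * Q) ^ k * |normSeq Q σ (r + k)|)
  have hbound : ∀ n, |σ ^ (-(n + 1)) * kernel (normSeq Q σ) g (n + 1) r -
      σ ^ (-n) * kernel (normSeq Q σ) g n r| ≤ Q ^ n * K := fun n => by
    rw [zpow_neg_mul_kernel hσ0, zpow_neg_mul_kernel hσ0,
      ← (summable_coeff_mul hQ0 hQ1 hσ0 hσ1 hg _ r).tsum_sub
        (summable_coeff_mul hQ0 hQ1 hσ0 hσ1 hg _ r)]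
    refine tsum_of_norm_bounded (f := fun k =>
      g k * (σ ^ k * normSeq Q σ (r + k)) * besselSeq Q (σ ^ 2) (n + 1 + k) -
      g k * (σ ^ k * normSeq Q σ (r + k)) * besselSeq Q (σ ^ 2) (n + k))
      (hs.hasSum.mul_left (Q ^ n)) fun k => ?_
    have h1 := hB.2 (n + k + 1)
    rw [add_sub_cancel_right, abs_sub_comm] at h1
    rw [← mul_sub, show n + 1 + k = n + k + 1 by ring, norm_mul, norm_mul, norm_mul,
      Real.norm_of_nonneg (zpow_pos hσ0 k).le]
    simp only [Real.norm_eq_abs]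
    calc _ ≤ C * (σ ^ k * |normSeq Q σ (r + k)|) * (B * Q ^ (n + k + 1)) := by
          have := (zpow_pos hσ0 k).le
          gcongr
          exact hg k
      _ = _ := by
          rw [zpow_add_one₀ hQ0.ne', zpow_add₀ hQ0.ne', mul_zpow]; ring
  have hlim := (tendsto_zpow_atTop_zero (pow_pos hσ0 2)
    (pow_lt_one₀ hσ0.le hσ1 two_ne_zero)).mul_const K
  rw [zero_mul] at hlim
  refine squeeze_zero_norm (fun n => ?_) hlim
  have hp : 0 < (σ ^ 2 / Q) ^ n := by positivity
  rw [norm_mul, Real.norm_of_nonneg hp.le]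
  refine (mul_le_mul_of_nonneg_left (hbound n) hp.le).trans_eq ?_
  rw [div_zpow]
  have := (zpow_pos hQ0 n).ne'
  field_simp

/-- Nonnegativity of the resolvent kernel. -/
lemma kernel_resolvent_nonneg (hQ0 : 0 < Q) (hQ1 : Q < 1) (hσ0 : 0 < σ) (hσ1 : σ < 1) {s : ℝ}
    (hs : 0 ≤ s) (n r : ℤ) : 0 ≤ kernel (normSeq Q σ) (fun k => (1 + s * Q ^ k)⁻¹) n r := by
  have hS := summable_abs_normSeq hQ0 hQ1 hσ0 hσ1
  have hone := kernel_one (tsum_normSeq_mul_normSeq hQ0 hQ1 hσ0 hσ1)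
  -- The case s = 0 is the identity; it is separated because the bound on Q^k g(k) below is 1/s.
  rcases hs.eq_or_lt with rfl | hs
  · simp only [zero_mul, add_zero, inv_one, hone]
    split_ifs <;> norm_num
  set g : ℤ → ℝ := fun k => (1 + s * Q ^ k)⁻¹ with hgdef
  have hQk : ∀ k : ℤ, 0 < Q ^ k := fun k => zpow_pos hQ0 k
  have hpos : ∀ k : ℤ, 0 < 1 + s * Q ^ k := fun k => by have := hQk k; positivity
  have hg : ∀ k, |g k| ≤ 1 := fun k => by
    rw [abs_of_pos (inv_pos.2 (hpos k))]
    exact inv_le_one_of_one_le₀ (by have := mul_pos hs (hQk k); linarith)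
  have hg' : ∀ k, |Q ^ k * g k| ≤ 1 / s := fun k => by
    rw [abs_of_pos (mul_pos (hQk k) (inv_pos.2 (hpos k))), ← div_eq_mul_inv,
      div_le_div_iff₀ (hpos k) hs]
    linarith
  -- Resolvent equation with a Dirac right-hand side, from g(k) + s Q^k g(k) = 1.
  have hdecomp : ∀ n, kernel (normSeq Q σ) g n r +
      s * kernel (normSeq Q σ) (fun k => Q ^ k * g k) n r = if n = r then 1 else 0 := fun n => by
    rw [← hone, kernel, kernel, ← tsum_mul_left, ← (summable_kernel hS hg n r).tsum_add
      ((summable_kernel hS hg' n r).mul_left s)]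
    refine tsum_congr fun k => ?_
    have := (hpos k).ne'
    simp only [hgdef]
    field_simp
  have hU := nonneg_of_supersolution (U := fun n => σ ^ (-n) * kernel (normSeq Q σ) g n r)
    (β := σ ^ 2 / Q) (by positivity) (tendsto_kernel_atBot hQ0 hQ1 hσ0 hσ1 hg r)
    -- Where U < 0, the nonnegative right-hand side forces the kernel of Q^k g(k) to be positive,
    -- and `kernel_rec` then makes the second-order difference strictly negative.
    (tendsto_kernel_sub_atTop hQ0 hQ1 hσ0 hσ1 hg r) (fun n hn => by
      have h1 := kernel_rec hQ0 hQ1 hσ0 hσ1 hg n r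
      have hσn : 0 < σ ^ (-n) := zpow_pos hσ0 _
      have h2 : kernel (normSeq Q σ) g n r < 0 := by
        by_contra! hc
        exact absurd hn (not_lt.2 (mul_nonneg hσn.le hc))
      have h3 : 0 < kernel (normSeq Q σ) (fun k => Q ^ k * g k) n r := by
        have h4 := hdecomp n
        have h5 : (0 : ℝ) ≤ if n = r then 1 else 0 := by split_ifs <;> norm_num
        rw [← h4] at h5
        exact pos_of_mul_pos_right (by linarith : 0 < s * _) hs.le
      have h6 := mul_pos (hQk n) (mul_pos hσn h3)
      linarith) n
  exact nonneg_of_mul_nonneg_right hU (zpow_pos hσ0 _)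

/-- Euler's limit exp(-x) = lim (1 + x/m)^(-m) on symbols; powers of the resolvent stay nonnegative
by multiplicativity, and dominated convergence passes to the kernels. -/
lemma kernel_exp_nonneg (hQ0 : 0 < Q) (hQ1 : Q < 1) (hσ0 : 0 < σ) (hσ1 : σ < 1) {t : ℝ}
    (ht : 0 ≤ t) (n r : ℤ) : 0 ≤ kernel (normSeq Q σ) (fun k => Real.exp (-t * Q ^ k)) n r := by
  have hle : ∀ (m : ℕ) (k : ℤ), |(1 + t / m * Q ^ k)⁻¹| ≤ 1 := fun m k => by
    have := zpow_pos hQ0 k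
    have h1 : 0 ≤ t / m * Q ^ k := by positivity
    rw [abs_of_nonneg (by positivity)]
    exact inv_le_one_of_one_le₀ (by linarith)
  have hS := summable_abs_normSeq hQ0 hQ1 hσ0 hσ1
  refine ge_of_tendsto' (tendsto_kernel hS (C := 1)
    (G := fun m k => (1 + t / m * Q ^ k)⁻¹ ^ m) (fun m k => ?_) (fun k => ?_) n r) fun m => ?_
  · rw [abs_pow]
    exact pow_le_one₀ (abs_nonneg _) (hle m k)
  · have h := (Real.tendsto_one_add_div_pow_exp (t * Q ^ k)).inv₀ (Real.exp_ne_zero _)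
    rw [← Real.exp_neg, ← neg_mul] at h
    refine h.congr fun m => ?_
    rw [inv_pow, div_mul_eq_mul_div]
  · exact kernel_pow_nonneg hS (tsum_normSeq_mul_normSeq hQ0 hQ1 hσ0 hσ1) (hle m)
      (kernel_resolvent_nonneg hQ0 hQ1 hσ0 hσ1 (by positivity)) m n r

lemma abs_exp_neg_sub_exp_neg_le {a b : ℝ} (ha : 0 ≤ a) (hb : 0 ≤ b) :
    |Real.exp (-a) - Real.exp (-b)| ≤ |a - b| := by
  wlog hab : a ≤ b generalizing a b
  · rw [abs_sub_comm, abs_sub_comm a]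
    exact this hb ha (le_of_not_ge hab)
  have h1 : Real.exp (-b) ≤ Real.exp (-a) := Real.exp_le_exp.2 (by linarith)
  have h2 : Real.exp (-a) ≤ 1 := Real.exp_le_one_iff.2 (by linarith)
  have h3 := Real.add_one_le_exp (-(b - a))
  have h4 : Real.exp (-b) = Real.exp (-a) * Real.exp (-(b - a)) := by
    rw [← Real.exp_add]; congr 1; ring
  rw [abs_of_nonneg (by linarith), abs_sub_comm, abs_of_nonneg (by linarith), h4]
  nlinarith [Real.exp_pos (-a)]

lemma hasDerivWithinAt_kernel (hQ0 : 0 < Q) (hQ1 : Q < 1) (hσ0 : 0 < σ) (hσ1 : σ < 1) {t : ℝ}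
    (ht : 0 ≤ t) (n r : ℤ) :
    HasDerivWithinAt (fun τ => kernel (normSeq Q σ) (fun k => Real.exp (-τ * Q ^ k)) n r)
      (-kernel (normSeq Q σ) (fun k => Q ^ k * Real.exp (-t * Q ^ k)) n r) (Set.Ici 0) t := by
  have hS := summable_abs_normSeq hQ0 hQ1 hσ0 hσ1
  have hexp : ∀ τ : ℝ, 0 ≤ τ → ∀ k : ℤ, |Real.exp (-τ * Q ^ k)| ≤ 1 := fun τ hτ k => by
    rw [Real.abs_exp, Real.exp_le_one_iff, neg_mul, neg_nonpos]
    exact mul_nonneg hτ (zpow_pos hQ0 k).le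
  rw [hasDerivWithinAt_iff_tendsto_slope, kernel, ← tsum_neg]
  -- The symbol Q^k of the generator is unbounded at k → -∞, but Q^k |S(r+k)| is still summable and
  -- dominates all difference quotients.
  have hb := (summable_normSeq_mul hQ0 hQ1 hσ0 hσ1 hQ0 hQ1.le r).mul_left
    (∑' k, |normSeq Q σ k|)
  have hlim := tendsto_tsum_of_dominated_convergence (𝓕 := 𝓝[Set.Ici 0 \ {t}] t)
    (f := fun τ k => slope (fun τ => Real.exp (-τ * Q ^ k)) t τ *
      (normSeq Q σ (n + k) * normSeq Q σ (r + k)))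
    (g := fun k => -(Q ^ k * Real.exp (-t * Q ^ k) *
      (normSeq Q σ (n + k) * normSeq Q σ (r + k)))) hb (fun k => ?_) ?_
  · refine hlim.congr' ?_
    filter_upwards [self_mem_nhdsWithin] with τ hτ
    rw [slope_def_field, kernel, kernel, ← (summable_kernel hS (hexp τ hτ.1) n r).tsum_sub
      (summable_kernel hS (hexp t ht) n r), ← tsum_div_const]
    refine tsum_congr fun k => ?_
    rw [slope_def_field]
    ring
  · have hd : HasDerivAt (fun τ : ℝ => Real.exp (-τ * Q ^ k))
        (Real.exp (-t * Q ^ k) * (-1 * Q ^ k)) t :=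
      (((hasDerivAt_id t).neg).mul_const (Q ^ k)).exp
    have h1 := (hasDerivWithinAt_iff_tendsto_slope.1 (hd.hasDerivWithinAt (s := Set.Ici 0))).mul_const
      (normSeq Q σ (n + k) * normSeq Q σ (r + k))
    convert h1 using 2
    ring
  · filter_upwards [self_mem_nhdsWithin] with τ hτ k
    have hQk := zpow_pos hQ0 k
    have hne : 0 < |τ - t| := abs_pos.2 (sub_ne_zero.2 hτ.2)
    have h1 : |slope (fun τ => Real.exp (-τ * Q ^ k)) t τ| ≤ Q ^ k := by
      rw [slope_def_field, abs_div, div_le_iff₀ hne, neg_mul, neg_mul]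
      refine (abs_exp_neg_sub_exp_neg_le (mul_nonneg hτ.1 hQk.le) (mul_nonneg ht hQk.le)).trans_eq ?_
      rw [← sub_mul, abs_mul, abs_of_pos hQk, mul_comm]
    rw [norm_mul, norm_mul]
    calc _ ≤ Q ^ k * ((∑' k, |normSeq Q σ k|) * |normSeq Q σ (r + k)|) :=
          mul_le_mul h1 (mul_le_mul_of_nonneg_right (abs_le_tsum_abs hS _) (abs_nonneg _))
            (by positivity) hQk.le
      _ = _ := by ring

/-- The heat kernel has total mass one. -/
lemma hasSum_kernel_exp (hQ0 : 0 < Q) (hQ1 : Q < 1) (hσ0 : 0 < σ) (hσ1 : σ < 1) {t : ℝ}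
    (ht : 0 ≤ t) (r : ℤ) :
    HasSum (fun n => σ ^ (n - r) * kernel (normSeq Q σ) (fun k => Real.exp (-t * Q ^ k)) n r)
      1 := by
  have hw0 := pow_pos hσ0 2
  have hw1 := pow_lt_one₀ hσ0.le hσ1 two_ne_zero
  have hS := summable_abs_normSeq hQ0 hQ1 hσ0 hσ1
  -- ψ alone need not be summable at +∞. Subtracting the symbol 1, whose kernel is the Dirac mass,
  -- leaves a factor O(Q^k) that permits exchanging the sums.
  set u : ℤ → ℝ := fun k => (Real.exp (-t * Q ^ k) - 1) * besselSeq Q (σ ^ 2) (r + k)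
  set v : ℤ → ℝ := fun k => (σ ^ 2) ^ k * besselSeq Q (σ ^ 2) k
  have habs : ∀ k : ℤ, |Real.exp (-t * Q ^ k) - 1| ≤ t * Q ^ k := fun k => by
    have h0 := mul_nonneg ht (zpow_pos hQ0 k).le
    have h := abs_exp_neg_sub_exp_neg_le h0 le_rfl
    rwa [neg_zero, Real.exp_zero, sub_zero, abs_of_nonneg h0, ← neg_mul] at h
  have hu : Summable fun k => |u k| := by
    refine ((summable_int_shift (summable_besselSeq hQ0 hQ1 hw0 hQ0 hQ1) r).mul_left
      (t * Q ^ (-r))).of_norm_bounded fun k => ?_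
    rw [norm_abs_eq_norm, norm_mul, add_comm k]
    refine (mul_le_mul_of_nonneg_right (habs k) (norm_nonneg _)).trans_eq ?_
    rw [zpow_neg, zpow_add₀ hQ0.ne', Real.norm_eq_abs]
    have := (zpow_pos hQ0 r).ne'
    field_simp
  have hv : Summable fun k => |v k| := by
    refine (summable_besselSeq hQ0 hQ1 hw0 hw0 hw1).congr fun k => ?_
    rw [abs_mul, abs_of_pos (zpow_pos hw0 k), mul_comm]
  have h1 := hasSum_convolution_mul hu hv (θ := fun _ => 1) (C := 1) (by simp)
  -- Each inner sum is a shift of ∑ w^n ψ(n) = 0, so only the Dirac mass contributes.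
  have hv0 : ∀ k, ∑' n, v (n + k) = 0 := fun k => by
    rw [tsum_int_shift v k]; exact tsum_besselSeq_zero hQ0 hQ1 hw0 hw1
  simp only [mul_one, hv0, mul_zero, tsum_zero] at h1
  have h2 := (hasSum_ite_eq r (1 : ℝ)).add h1
  rw [add_zero] at h2
  refine h2.congr_fun fun n => ?_
  have hone := kernel_one (tsum_normSeq_mul_normSeq hQ0 hQ1 hσ0 hσ1) n r
  have e1 : (if n = r then (1 : ℝ) else 0) = σ ^ (n - r) * kernel (normSeq Q σ) (fun _ => 1) n r := by
    rw [hone]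
    split_ifs with h <;> simp [h]
  have hexp : ∀ k : ℤ, |Real.exp (-t * Q ^ k)| ≤ 1 := fun k => by
    rw [Real.abs_exp, Real.exp_le_one_iff, neg_mul, neg_nonpos]
    exact mul_nonneg ht (zpow_pos hQ0 k).le
  have e2 : ∑' k, u k * v (n + k) =
      σ ^ (n - r) * (kernel (normSeq Q σ) (fun k => Real.exp (-t * Q ^ k)) n r -
        kernel (normSeq Q σ) (fun _ => 1) n r) := by
    rw [kernel, kernel, ← (summable_kernel hS hexp n r).tsum_sub
      (summable_kernel hS (g := fun _ => 1) (C := 1) (by simp) n r), ← tsum_mul_left]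
    refine tsum_congr fun k => ?_
    simp only [u, v, normSeq]
    have e3 : (σ ^ 2) ^ (n + k) = σ ^ (n - r) * (σ ^ (n + k) * σ ^ (r + k)) := by
      rw [← zpow_add₀ hσ0.ne', ← zpow_add₀ hσ0.ne', ← zpow_natCast σ 2, ← zpow_mul]
      congr 1
      push_cast
      ring
    rw [e3]
    ring
  rw [e1, e2]
  ring

end normSeq

/-! ### Return to the grid q^ℤ and to the transition probabilities -/

section grid

variable {q ν : ℝ}

lemma qBesselC_pos (hq0 : 0 < q) (hq1 : q < 1) (hν : -1 < ν) : 0 < qBesselC q ν := by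
  have hQ0 : 0 < q ^ 2 := by positivity
  have hQ1 : q ^ 2 < 1 := pow_lt_one₀ hq0.le hq1 two_ne_zero
  have h1 := qPochInf_pos hQ0.le hQ1 hQ0 hQ1
  have h2 := qPochInf_pos (Real.rpow_pos_of_pos hq0 (2 * ν + 2)).le
    (Real.rpow_lt_one hq0.le hq1 (by linarith)) hQ0 hQ1
  have h3 := sub_pos.2 hq1
  unfold qBesselC
  positivity

lemma rpow_add_one_sq (hq0 : 0 < q) : (q ^ (ν + 1)) ^ 2 = q ^ (2 * ν + 2) := by
  rw [← Real.rpow_natCast (q ^ (ν + 1)) 2, ← Real.rpow_mul hq0.le]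
  congr 1
  push_cast
  ring

lemma qBesselJ_zpow (hq0 : 0 < q) (hq1 : q < 1) (hν : -1 < ν) (n : ℤ) :
    qBesselJ q ν (q ^ n) = ((1 - q) * qBesselC q ν)⁻¹ * (q ^ (ν + 1)) ^ (-n) *
      normSeq (q ^ 2) (q ^ (ν + 1)) n := by
  have h := qBesselC_mul_qBesselJ hq0 hq1 hν n
  have hC := (qBesselC_pos hq0 hq1 hν).ne'
  have h1 := (sub_pos.2 hq1).ne'
  have hσ := (zpow_pos (Real.rpow_pos_of_pos hq0 (ν + 1)) n).ne'
  rw [normSeq, rpow_add_one_sq hq0, ← h, zpow_neg]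
  field_simp

lemma zpow_mul_fpIntegrand (hq0 : 0 < q) (hq1 : q < 1) (hν : -1 < ν) (n r k : ℤ) (t : ℝ) :
    q ^ k * fpIntegrand q ν (q ^ r) (q ^ n) t (q ^ k) =
      ((1 - q) * qBesselC q ν)⁻¹ ^ 2 * ((q ^ (ν + 1)) ^ (-n) * (q ^ (ν + 1)) ^ (-r)) *
        (Real.exp (-t * (q ^ 2) ^ k) * (normSeq (q ^ 2) (q ^ (ν + 1)) (n + k) *
          normSeq (q ^ 2) (q ^ (ν + 1)) (r + k))) := by
  have hσ0 := Real.rpow_pos_of_pos hq0 (ν + 1)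
  have h1 : q ^ k * (q ^ k) ^ (2 * ν + 1) = (q ^ (ν + 1)) ^ k * (q ^ (ν + 1)) ^ k := by
    rw [← Real.rpow_intCast q k, ← Real.rpow_intCast _ k, ← Real.rpow_mul hq0.le,
      ← Real.rpow_mul hq0.le, ← Real.rpow_add hq0, ← Real.rpow_add hq0]
    congr 1
    ring
  have h2 : (q ^ k) ^ 2 = (q ^ 2) ^ k := by
    rw [← zpow_natCast, ← zpow_natCast, ← zpow_mul, ← zpow_mul, mul_comm]
  rw [fpIntegrand, ← zpow_add₀ hq0.ne', ← zpow_add₀ hq0.ne', qBesselJ_zpow hq0 hq1 hν,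
    qBesselJ_zpow hq0 hq1 hν, h2, neg_add, neg_add, zpow_add₀ hσ0.ne', zpow_add₀ hσ0.ne',
    zpow_neg _ k]
  have hk := (zpow_pos hσ0 k).ne'
  calc _ = (q ^ k * (q ^ k) ^ (2 * ν + 1)) * Real.exp (-t * (q ^ 2) ^ k) *
        (((1 - q) * qBesselC q ν)⁻¹ * ((q ^ (ν + 1)) ^ (-n) * ((q ^ (ν + 1)) ^ k)⁻¹) *
          normSeq (q ^ 2) (q ^ (ν + 1)) (n + k)) *
        (((1 - q) * qBesselC q ν)⁻¹ * ((q ^ (ν + 1)) ^ (-r) * ((q ^ (ν + 1)) ^ k)⁻¹) *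
          normSeq (q ^ 2) (q ^ (ν + 1)) (r + k)) := by ring
    _ = _ := by
      rw [h1]
      field_simp

lemma fpSolution_zpow (hq0 : 0 < q) (hq1 : q < 1) (hν : -1 < ν) (n r : ℤ) (t : ℝ) :
    fpSolution q ν (q ^ r) (q ^ n) t =
      (1 - q)⁻¹ * (q ^ (ν + 1)) ^ (-r) * ((q ^ (ν + 1)) ^ (-n) *
        kernel (normSeq (q ^ 2) (q ^ (ν + 1))) (fun k => Real.exp (-t * (q ^ 2) ^ k)) n r) := by
  have hC := (qBesselC_pos hq0 hq1 hν).ne'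
  have h1 := (sub_pos.2 hq1).ne'
  rw [fpSolution, jacksonIntegral, tsum_congr fun k => zpow_mul_fpIntegrand hq0 hq1 hν n r k t,
    tsum_mul_left, ← kernel]
  field_simp

/-- The prefactor σ^(n-r) is multiplicative along n, k, r, so Chapman–Kolmogorov for the kernels
carries over unchanged. -/
lemma transProb_eq (hq0 : 0 < q) (hq1 : q < 1) (hν : -1 < ν) (n r : ℤ) (t : ℝ) :
    transProb q ν n r t = (q ^ (ν + 1)) ^ (n - r) *
      kernel (normSeq (q ^ 2) (q ^ (ν + 1))) (fun k => Real.exp (-t * (q ^ 2) ^ k)) n r := by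
  have h1 := (sub_pos.2 hq1).ne'
  have hσ0 := Real.rpow_pos_of_pos hq0 (ν + 1)
  have hn := (zpow_pos hσ0 n).ne'
  have e : q ^ (2 * (ν + 1) * n) = (q ^ (ν + 1)) ^ n * (q ^ (ν + 1)) ^ n := by
    rw [← Real.rpow_intCast _ n, ← Real.rpow_mul hq0.le, ← Real.rpow_add hq0]
    congr 1
    ring
  rw [transProb, fpSolution_zpow hq0 hq1 hν, e, zpow_sub₀ hσ0.ne', zpow_neg, zpow_neg]
  field_simp

end grid

end QFokkerPlanck

theorem proposition1 (ν : ℝ) (hν : -1 < ν) (q : ℝ) (hq : q ∈ QFokkerPlanck.positivitySet ν) :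
    -- the Jackson integral defining `P` converges
    (∀ x₀ ∈ QFokkerPlanck.qGrid q, ∀ x ∈ QFokkerPlanck.qGrid q, ∀ t : ℝ, 0 ≤ t →
      QFokkerPlanck.JacksonIntegrable q (QFokkerPlanck.fpIntegrand q ν x₀ x t)) ∧
    -- `P` solves the `q`-Fokker–Planck equation (with the right derivative at `t = 0`)
    (∀ x₀ ∈ QFokkerPlanck.qGrid q, ∀ x ∈ QFokkerPlanck.qGrid q, ∀ t : ℝ, 0 ≤ t →
      HasDerivWithinAt (fun τ => QFokkerPlanck.fpSolution q ν x₀ x τ)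
        (QFokkerPlanck.qBesselOp q ν (fun z => QFokkerPlanck.fpSolution q ν x₀ z t) x)
        (Set.Ici 0) t) ∧
    -- nonnegativity
    (∀ n r : ℤ, ∀ t : ℝ, 0 ≤ t → 0 ≤ QFokkerPlanck.transProb q ν n r t) ∧
    -- total mass one
    (∀ r : ℤ, ∀ t : ℝ, 0 ≤ t → HasSum (fun n : ℤ => QFokkerPlanck.transProb q ν n r t) 1) ∧
    -- initial condition
    (∀ n r : ℤ, QFokkerPlanck.transProb q ν n r 0 = if n = r then 1 else 0) ∧
    -- Chapman–Kolmogorov identity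
    (∀ n r : ℤ, ∀ t s : ℝ, 0 ≤ t → 0 ≤ s →
      HasSum (fun k : ℤ => QFokkerPlanck.transProb q ν n k t * QFokkerPlanck.transProb q ν k r s)
        (QFokkerPlanck.transProb q ν n r (t + s))) := by
  obtain ⟨⟨hq0, hq1⟩, -⟩ := hq
  have hQ0 : 0 < q ^ 2 := by positivity
  have hQ1 : q ^ 2 < 1 := pow_lt_one₀ hq0.le hq1 two_ne_zero
  have hσ0 : 0 < q ^ (ν + 1) := Real.rpow_pos_of_pos hq0 _
  have hσ1 : q ^ (ν + 1) < 1 := Real.rpow_lt_one hq0.le hq1 (by linarith)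
  have hS := QFokkerPlanck.summable_abs_normSeq hQ0 hQ1 hσ0 hσ1
  have horth := QFokkerPlanck.tsum_normSeq_mul_normSeq hQ0 hQ1 hσ0 hσ1
  have hexp : ∀ t : ℝ, 0 ≤ t → ∀ k : ℤ, |Real.exp (-t * (q ^ 2) ^ k)| ≤ 1 := fun t ht k => by
    rw [Real.abs_exp, Real.exp_le_one_iff, neg_mul, neg_nonpos]
    exact mul_nonneg ht (zpow_pos hQ0 k).le
  refine ⟨?_, ?_, ?_, ?_, ?_, ?_⟩
  · rintro _ ⟨r, rfl⟩ _ ⟨n, rfl⟩ t ht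
    exact ((QFokkerPlanck.summable_kernel hS (hexp t ht) n r).mul_left _).congr fun k =>
      (QFokkerPlanck.zpow_mul_fpIntegrand hq0 hq1 hν n r k t).symm
  · rintro _ ⟨r, rfl⟩ _ ⟨n, rfl⟩ t ht
    have hd := ((QFokkerPlanck.hasDerivWithinAt_kernel hQ0 hQ1 hσ0 hσ1 ht n r).const_mul
      ((q ^ (ν + 1)) ^ (-n))).const_mul ((1 - q)⁻¹ * (q ^ (ν + 1)) ^ (-r))
    simp only [QFokkerPlanck.fpSolution_zpow hq0 hq1 hν]
    refine hd.congr_deriv (Eq.symm ?_)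
    have hrec := QFokkerPlanck.kernel_rec hQ0 hQ1 hσ0 hσ1 (hexp t ht) n r
    -- Matches the coefficient q^(2ν) of Δ_{q,ν} with w/Q in `kernel_rec`; the division by x²
    -- becomes division by Q^n.
    have hβ : q ^ (2 * ν) = (q ^ (ν + 1)) ^ 2 / q ^ 2 := by
      rw [QFokkerPlanck.rpow_add_one_sq hq0, Real.rpow_add hq0, Real.rpow_two,
        mul_div_cancel_right₀ _ hQ0.ne']
    have h2 : (q ^ n) ^ 2 = (q ^ 2) ^ n := by
      rw [← zpow_natCast, ← zpow_natCast, ← zpow_mul, ← zpow_mul, mul_comm]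
    rw [QFokkerPlanck.qBesselOp, show q⁻¹ * q ^ n = q ^ (n - 1) by
      rw [zpow_sub_one₀ hq0.ne', mul_comm], ← zpow_one_add₀ hq0.ne', add_comm 1 n, hβ, h2]
    simp only [QFokkerPlanck.fpSolution_zpow hq0 hq1 hν]
    rw [div_eq_iff (zpow_pos hQ0 n).ne']
    linear_combination ((1 - q)⁻¹ * (q ^ (ν + 1)) ^ (-r)) * hrec
  · intro n r t ht
    rw [QFokkerPlanck.transProb_eq hq0 hq1 hν]
    exact mul_nonneg (zpow_pos hσ0 _).le
      (QFokkerPlanck.kernel_exp_nonneg hQ0 hQ1 hσ0 hσ1 ht n r)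
  · intro r t ht
    simp only [QFokkerPlanck.transProb_eq hq0 hq1 hν]
    exact QFokkerPlanck.hasSum_kernel_exp hQ0 hQ1 hσ0 hσ1 ht r
  · intro n r
    rw [QFokkerPlanck.transProb_eq hq0 hq1 hν]
    simp only [neg_zero, zero_mul, Real.exp_zero, QFokkerPlanck.kernel_one horth]
    split_ifs with h <;> simp [h]
  · intro n r t s ht hs
    simp only [QFokkerPlanck.transProb_eq hq0 hq1 hν]
    have h := (QFokkerPlanck.hasSum_kernel_mul_kernel hS horth (hexp t ht) (hexp s hs) n r).mul_left
      ((q ^ (ν + 1)) ^ (n - r))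
    have hadd : (fun k : ℤ => Real.exp (-(t + s) * (q ^ 2) ^ k)) =
        fun k => Real.exp (-t * (q ^ 2) ^ k) * Real.exp (-s * (q ^ 2) ^ k) := funext fun k => by
      rw [← Real.exp_add]
      congr 1
      ring
    rw [hadd]
    refine h.congr_fun fun k => ?_
    rw [← sub_add_sub_cancel n k r, zpow_add₀ hσ0.ne']
    ring
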